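/- Let $\chi$ be a Dirichlet character, let $a>0$, $\alpha\neq 0$ and $b$ be real numbers, and put $\gamma(t)=\alpha t^a(\log t)^b$ for $t>1$. Let $L(s;\chi)$ denote the (analytically continued) Dirichlet $L$-function of $\chi$, and for a positive integer $y$ put \[ L_{p\le y}(s;\chi)=\prod_{p\le y}\Bigl(1-\frac{\chi(p)}{p^s}\Bigr)^{-1}, \] the product being over primes. Let $K\subset\{s\in\mathbb{C}:\tfrac12<\operatorname{Re}(s)<1\}$ be a compact set. Then for every $\varepsilon>0$ there is $y_0$ such that for every integer $y\ge y_0$ there is $T_0$ such that for all $T\ge T_0$ \[ \operatorname{meas}\Bigl\{\tau\in(1,T]:\ \max_{s\in K}\bigl|L(s+i\gamma(\tau);\chi)-L_{p\le y}(s+i\gamma(\tau);\chi)\bigr|<\varepsilon\Bigr\}>(1-\varepsilon)T , \] where $\operatorname{meas}$ is Lebesgue measure on $\mathbb{R}$. In particular, the same lower bound holds with $\tau$ ranging over $[0,T]$. -/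

import Mathlib

/-- The additive character `e(t) = exp(2πit)`. -/
noncomputable def eAdd (t : ℝ) : ℂ :=
  Complex.exp (2 * (Real.pi : ℂ) * Complex.I * (t : ℂ))

/-- The finite (twisted) Euler product
`L_M(s, (θ_p); χ) = ∏_{p ∈ M} (1 - χ(p) e(-θ_p) / p^s)⁻¹`;
it is meant for finite sets `M` of primes. -/
noncomputable def eulerProd {q : ℕ} (M : Finset ℕ) (s : ℂ) (θ : ℕ → ℝ)
    (χ : DirichletCharacter ℂ q) : ℂ :=
  ∏ p ∈ M, (1 - χ (p : ZMod q) * eAdd (-θ p) / (p : ℂ) ^ s)⁻¹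

/-- The set of primes `p ≤ y`. -/
def primesUpTo (y : ℕ) : Finset ℕ :=
  (Finset.range (y + 1)).filter Nat.Prime

/-- The function `γ(t) = α t^a (log t)^b`, meant for `t > 1`. -/
noncomputable def gammaCurve (α a b : ℝ) (t : ℝ) : ℝ :=
  α * t ^ a * (Real.log t) ^ b

/-!
Write `F = L(·; χ) - L_{p ≤ y}(·; χ)`, the Dirichlet series whose coefficients are `χ n` at the `n`
with a prime factor larger than `y` (`eulerTail`, `roughCoeff`). The heart of the matter is a mean
value theorem of Carlson type, `exists_lintegral_eulerTail_sq_le`: on each line `re s = σ` of a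
closed substrip of `1/2 < re s < 1`, the integral of `|F(σ + it)|²` over `|t| ≤ U` is at most `δ U`,
where `δ` is small once `y` is large, and `U` is large in terms of `y`.

The mean value theorem comes from Plancherel's identity rather than from an approximate functional
equation. If `E(x) = ∑_{n ≤ x} f n - c x` is the error in the summatory function of the coefficients
`f n` of `F` (with `c` the mean value of `χ`), then `F(s) / s` is the Mellin transform of `E` at
`-s` for `0 < re s < 1`, `im s ≠ 0` (`mul_mellin_sumError`; the term `c x` on `(0, 1)` accounts for
the pole at `s = 1`). Hence `(e^{hs} - 1) F(s) / s` is the transform of the increment `E(e^h x) - E(x)`. For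
`h = 1 / (4U)` and `|t| ≤ U` the factor `(e^{hs} - 1) / s` has size comparable to `h`, so the mean
square of `F` is at most a constant times `h⁻²` times the weighted mean square of the increments.
When `x ≤ 1 / (4h)`, the window `(x, e^h x]` contains at most one integer, which must exceed `y`
for the increment to be more than the small linear term. These windows contribute
`≪ h ∑_{n > y} n^{-2σ}`, and that is the main term. For larger `x` the bound `E(x) ≪ x^κ` with
small `κ`, which follows from the periodicity of `χ` and Rankin's bound for smooth numbers, gives
`o(h)` (`exists_lintegral_windowProfile_le`).

Cauchy's formula for `F²` on finitely many circles around points of `K`, together with Markov's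
inequality, turns this into a bound `δ V` for the measure of the shifts `u ∈ [-V, V]` at which `F`
is not small on `K + iu` (`exists_volume_badShifts_le`). Finally the curve `γ` is injective on
`[ηT, T]` with speed `≫ |γ(T)| / T`, so the change of variables `u = γ(τ)` transports this bound to
the variable `τ` (`volume_preimage_gammaCurve_le`).
-/

/-! ### Plancherel's identity on `L¹ ∩ L²` -/

open MeasureTheory FourierTransform SchwartzMap in
/-- The Fourier integral agrees with the `L²` Fourier transform: both define the same tempered
distribution. -/
lemma fourierIntegral_ae_eq_fourier_toLp {g : ℝ → ℂ} (hg1 : Integrable g) (hg2 : MemLp g 2) :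
    𝓕 g =ᵐ[volume] (𝓕 (hg2.toLp g) : Lp ℂ 2 (volume : Measure ℝ)) := by
  have hcont : Continuous (𝓕 g) :=
    VectorFourier.fourierIntegral_continuous Real.continuous_fourierChar
      (by exact continuous_inner) hg1
  refine ae_eq_of_integral_contDiff_smul_eq hcont.locallyIntegrable
    ((Lp.memLp _).locallyIntegrable (by norm_num)) fun φ hφ hφc => ?_
  have hφ₁ : HasCompactSupport (Complex.ofRealCLM ∘ φ) := hφc.comp_left rfl
  have hφ₂ : ContDiff ℝ (⊤ : ℕ∞) (Complex.ofRealCLM ∘ φ) := by fun_prop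
  let ψ : 𝓢(ℝ, ℂ) := hφ₁.toSchwartzMap hφ₂
  have key := DFunLike.congr_fun
    (Lp.fourier_toTemperedDistribution_eq (hg2.toLp g)) ψ
  rw [TemperedDistribution.fourier_apply, Lp.toTemperedDistribution_apply,
    Lp.toTemperedDistribution_apply] at key
  have hL : ∫ x, (𝓕 ψ) x • (hg2.toLp g) x = ∫ x, ψ x • 𝓕 g x := by
    have h1 : ∫ x, (𝓕 ψ) x • (hg2.toLp g) x = ∫ x, (𝓕 (ψ : ℝ → ℂ)) x • g x := by
      refine integral_congr_ae ?_
      filter_upwards [hg2.coeFn_toLp] with x hx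
      rw [hx, SchwartzMap.fourier_coe]
    rw [h1]
    exact VectorFourier.integral_fourierIntegral_smul_eq_flip (L := innerₗ ℝ)
      Real.continuous_fourierChar continuous_inner ψ.integrable hg1
      |>.trans (by
        congr 1 with x
        congr 2
        ext; simp)
  rw [hL] at key
  simpa [ψ] using key

open MeasureTheory FourierTransform in
/-- Plancherel's identity for the Fourier integral of a function in `L¹ ∩ L²`. -/
lemma lintegral_enorm_fourier_sq {g : ℝ → ℂ} (hg1 : Integrable g) (hg2 : MemLp g 2) :
    ∫⁻ ξ, ‖𝓕 g ξ‖ₑ ^ 2 = ∫⁻ u, ‖g u‖ₑ ^ 2 := by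
  have h1 : eLpNorm (𝓕 g) 2 volume = eLpNorm g 2 volume := by
    rw [eLpNorm_congr_ae (fourierIntegral_ae_eq_fourier_toLp hg1 hg2),
      ← eLpNorm_congr_ae hg2.coeFn_toLp, ← Lp.enorm_def, ← Lp.enorm_def,
      ← ofReal_norm, ← ofReal_norm, Lp.norm_fourier_eq]
  have h2 := congrArg (fun x : ENNReal => x ^ (((2 : NNReal) : ℝ))) h1
  rw [show (2 : ENNReal) = ((2 : NNReal) : ENNReal) from rfl] at h2
  simp only [eLpNorm_nnreal_pow_eq_lintegral (p := 2) (by norm_num)] at h2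
  simpa using h2

/-! ### Coefficients and their summatory function -/

/-- The coefficients of the Dirichlet series `L(s; χ) - L_{p ≤ y}(s; χ)`: the values `χ n` at the
`n` that have a prime factor larger than `y`. The value at `n = 0` is irrelevant. -/
noncomputable def roughCoeff {q : ℕ} (χ : DirichletCharacter ℂ q) (y n : ℕ) : ℂ :=
  open Classical in if n ∈ (y + 1).smoothNumbers then 0 else χ (n : ZMod q)

/-- The difference `L(s; χ) - L_{p ≤ y}(s; χ)`. -/
noncomputable def eulerTail {q : ℕ} [NeZero q] (χ : DirichletCharacter ℂ q) (y : ℕ) (s : ℂ) : ℂ :=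
  χ.LFunction s - eulerProd (primesUpTo y) s (fun _ => 0) χ

/-- The mean value of `χ` over a period: `φ(q) / q` if `χ` is principal, and `0` otherwise. -/
noncomputable def charMean {q : ℕ} [NeZero q] (χ : DirichletCharacter ℂ q) : ℂ :=
  (∑ r : ZMod q, χ r) / q

/-- The error term in the approximation of the summatory function of `roughCoeff χ y` by a linear
function. -/
noncomputable def sumError {q : ℕ} [NeZero q] (χ : DirichletCharacter ℂ q) (y : ℕ) (x : ℝ) : ℂ :=
  ∑ k ∈ Finset.Icc 1 ⌊x⌋₊, roughCoeff χ y k - charMean χ * x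

section Coefficients

variable {q : ℕ} (χ : DirichletCharacter ℂ q)

lemma norm_roughCoeff_le (y n : ℕ) : ‖roughCoeff χ y n‖ ≤ 1 := by
  unfold roughCoeff
  split_ifs
  · simp
  · exact χ.norm_le_one _

lemma roughCoeff_eq_zero {y n : ℕ} (hn : n ≠ 0) (hny : n ≤ y) : roughCoeff χ y n = 0 := by
  have : n ∈ (y + 1).smoothNumbers :=
    Nat.mem_smoothNumbers_of_lt (Nat.pos_of_ne_zero hn) (Nat.lt_succ_of_le hny)
  simp [roughCoeff, this]

/-- Rankin's bound for the number of smooth numbers. -/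
lemma exists_norm_sum_smooth_le (y : ℕ) {κ : ℝ} (hκ : 0 < κ) :
    ∃ C : ℝ, 0 ≤ C ∧ ∀ N : ℕ, ‖∑ k ∈ Finset.Icc 1 N, (χ ((k : ℕ) : ZMod q) - roughCoeff χ y k)‖
      ≤ C * (N : ℝ) ^ κ := by
  classical
  let f : ℕ →* ℝ :=
    { toFun := fun n => (n : ℝ) ^ (-κ)
      map_one' := by simp
      map_mul' := fun m n => by
        push_cast; exact Real.mul_rpow (Nat.cast_nonneg _) (Nat.cast_nonneg _) }
  have hf0 : ∀ n, 0 ≤ f n := fun n => Real.rpow_nonneg (Nat.cast_nonneg _) _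
  have hsum : Summable (fun m : (y + 1).smoothNumbers => ‖f m‖) :=
    (EulerProduct.summable_and_hasSum_smoothNumbers_prod_primesBelow_geometric (f := f)
      (fun {p} hp => by
        rw [Real.norm_of_nonneg (hf0 p)]
        exact Real.rpow_lt_one_of_one_lt_of_neg (by exact_mod_cast hp.one_lt) (by linarith))
      (y + 1)).1
  have hsum' : Summable (Set.indicator ((y + 1).smoothNumbers) (fun m => f m)) := by
    rw [← summable_subtype_iff_indicator]
    exact hsum.of_norm
  have hind0 : ∀ n, 0 ≤ Set.indicator ((y + 1).smoothNumbers) (fun m => f m) n :=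
    fun n => Set.indicator_nonneg (fun m _ => hf0 m) n
  refine ⟨∑' n, Set.indicator ((y + 1).smoothNumbers) (fun m => f m) n, tsum_nonneg hind0,
    fun N => ?_⟩
  calc _ ≤ ∑ k ∈ Finset.Icc 1 N, ‖χ ((k : ℕ) : ZMod q) - roughCoeff χ y k‖ := norm_sum_le _ _
    _ ≤ ∑ k ∈ Finset.Icc 1 N,
        Set.indicator ((y + 1).smoothNumbers) (fun m => f m) k * (N : ℝ) ^ κ := by
      refine Finset.sum_le_sum fun k hk => ?_
      obtain ⟨hk1, hkN⟩ := Finset.mem_Icc.mp hk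
      have hk0 : (0 : ℝ) < k := by exact_mod_cast hk1
      by_cases h : k ∈ (y + 1).smoothNumbers
      · simp only [roughCoeff, h, if_true, sub_zero, Set.indicator_of_mem]
        refine (χ.norm_le_one _).trans ?_
        have : (k : ℝ) ^ κ ≤ (N : ℝ) ^ κ :=
          Real.rpow_le_rpow hk0.le (by exact_mod_cast hkN) hκ.le
        calc (1 : ℝ) = (k : ℝ) ^ (-κ) * (k : ℝ) ^ κ := by
              rw [← Real.rpow_add hk0]; simp
          _ ≤ (k : ℝ) ^ (-κ) * (N : ℝ) ^ κ :=
              mul_le_mul_of_nonneg_left this (Real.rpow_nonneg hk0.le _)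
      · simp [roughCoeff, h]
    _ = (∑ k ∈ Finset.Icc 1 N, Set.indicator ((y + 1).smoothNumbers) (fun m => f m) k)
        * (N : ℝ) ^ κ := by rw [Finset.sum_mul]
    _ ≤ _ := mul_le_mul_of_nonneg_right (hsum'.sum_le_tsum _ fun n _ => hind0 n)
        (Real.rpow_nonneg (Nat.cast_nonneg _) _)

variable [NeZero q]

lemma norm_charMean_le : ‖charMean χ‖ ≤ 1 := by
  have hq : (0 : ℝ) < q := by exact_mod_cast Nat.pos_of_ne_zero (NeZero.ne q)
  rw [charMean, norm_div, Complex.norm_natCast, div_le_one hq]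
  calc ‖∑ r : ZMod q, χ r‖ ≤ ∑ r : ZMod q, ‖χ r‖ := norm_sum_le _ _
    _ ≤ ∑ _r : ZMod q, (1 : ℝ) := Finset.sum_le_sum fun r _ => χ.norm_le_one r
    _ = q := by simp [ZMod.card]

lemma sum_range_char_period : ∑ k ∈ Finset.range q, χ ((k : ℕ) : ZMod q) = ∑ r : ZMod q, χ r := by
  refine Finset.sum_bij' (fun k _ => (k : ZMod q)) (fun r _ => r.val) (by simp) ?_ ?_ ?_ ?_
  · intro r _; simpa using ZMod.val_lt r
  · intro k hk; exact ZMod.val_cast_of_lt (by simpa using hk)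
  · intro r _; simp
  · intro k _; rfl

/-- The partial sums of `χ n - charMean χ` are periodic, hence bounded. -/
lemma norm_sum_char_sub_le (N : ℕ) :
    ‖∑ k ∈ Finset.Icc 1 N, χ ((k : ℕ) : ZMod q) - charMean χ * N‖ ≤ 2 * q + 2 := by
  have hq : (q : ℂ) ≠ 0 := by exact_mod_cast NeZero.ne q
  let D : ℕ → ℂ := fun N => ∑ k ∈ Finset.range N, (χ ((k : ℕ) : ZMod q) - charMean χ)
  have hper : Function.Periodic D q := by
    intro n
    have h0 : ∑ k ∈ Finset.range n, (χ (((q + k : ℕ)) : ZMod q) - charMean χ) = D n := by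
      simp [D]
    have h1 : D q = 0 := by
      simp only [D, Finset.sum_sub_distrib, sum_range_char_period, charMean]
      simp; field_simp; simp
    change D (n + q) = D n
    rw [← h0, add_comm, show D (q + n) = D q + _ from Finset.sum_range_add _ _ _, h1, zero_add]
  have hterm : ∀ k : ℕ, ‖χ ((k : ℕ) : ZMod q) - charMean χ‖ ≤ 2 := fun k =>
    (norm_sub_le _ _).trans (by linarith [χ.norm_le_one (k : ZMod q), norm_charMean_le χ])
  have hb : ∀ n, ‖D n‖ ≤ 2 * q := fun n => by
    rw [← hper.map_mod_nat n]
    calc ‖D (n % q)‖ ≤ ∑ k ∈ Finset.range (n % q), ‖χ ((k : ℕ) : ZMod q) - charMean χ‖ :=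
          norm_sum_le _ _
      _ ≤ ∑ k ∈ Finset.range (n % q), (2 : ℝ) := Finset.sum_le_sum fun k _ => hterm k
      _ = (n % q : ℕ) * 2 := by simp
      _ ≤ 2 * q := by
        have : ((n % q : ℕ) : ℝ) ≤ q := by
          exact_mod_cast (Nat.mod_lt n (Nat.pos_of_ne_zero (NeZero.ne q))).le
        linarith
  have hsum : ∑ k ∈ Finset.Icc 1 N, χ ((k : ℕ) : ZMod q) - charMean χ * N
      = D (N + 1) - (χ ((0 : ℕ) : ZMod q) - charMean χ) := by
    have : D (N + 1) = ∑ k ∈ Finset.Icc 1 N, (χ ((k : ℕ) : ZMod q) - charMean χ)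
        + (χ ((0 : ℕ) : ZMod q) - charMean χ) := by
      simp only [D]
      rw [Finset.sum_range_succ', Finset.range_eq_Ico, Finset.sum_Ico_add' (c := 1)
        (f := fun k => χ ((k : ℕ) : ZMod q) - charMean χ)]
      rfl
    rw [this]
    simp [mul_comm]
  rw [hsum]
  exact (norm_sub_le _ _).trans (add_le_add (hb _) (hterm 0))

lemma sumError_of_lt_one (y : ℕ) {x : ℝ} (hx : x < 1) : sumError χ y x = -(charMean χ * x) := by
  simp [sumError, Nat.floor_eq_zero.mpr hx]

lemma norm_sumError_le_of_lt_one (y : ℕ) {x : ℝ} (hx0 : 0 ≤ x) (hx : x < 1) :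
    ‖sumError χ y x‖ ≤ x := by
  rw [sumError_of_lt_one χ y hx, norm_neg, norm_mul, Complex.norm_real, Real.norm_of_nonneg hx0]
  exact mul_le_of_le_one_left hx0 (norm_charMean_le χ)

lemma exists_norm_sumError_le (y : ℕ) {κ : ℝ} (hκ : 0 < κ) (hκ1 : κ ≤ 1) :
    ∃ C : ℝ, 0 ≤ C ∧ ∀ x : ℝ, 0 < x → ‖sumError χ y x‖ ≤ C * x ^ κ := by
  obtain ⟨C, hC, hC'⟩ := exists_norm_sum_smooth_le χ y hκ
  refine ⟨C + 2 * q + 4, by positivity, fun x hx => ?_⟩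
  rcases lt_or_ge x 1 with h1 | h1
  · have h2 : x ≤ x ^ κ := by
      simpa using Real.rpow_le_rpow_of_exponent_ge hx h1.le hκ1
    have h3 := norm_sumError_le_of_lt_one χ y hx.le h1
    have : 0 ≤ x ^ κ := by positivity
    nlinarith [mul_nonneg (by positivity : (0 : ℝ) ≤ C + 2 * q) this]
  · have hxκ : 1 ≤ x ^ κ := Real.one_le_rpow h1 hκ.le
    have hfl : (⌊x⌋₊ : ℝ) ≤ x := Nat.floor_le hx.le
    have hfl' : x < ⌊x⌋₊ + 1 := Nat.lt_floor_add_one x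
    have hdec : sumError χ y x
        = (∑ k ∈ Finset.Icc 1 ⌊x⌋₊, χ ((k : ℕ) : ZMod q) - charMean χ * (⌊x⌋₊ : ℕ))
          - ∑ k ∈ Finset.Icc 1 ⌊x⌋₊, (χ ((k : ℕ) : ZMod q) - roughCoeff χ y k)
          - charMean χ * ((x - ⌊x⌋₊ : ℝ) : ℂ) := by
      rw [sumError, Finset.sum_sub_distrib]
      push_cast
      ring
    have hA := norm_sum_char_sub_le χ ⌊x⌋₊
    have hB := hC' ⌊x⌋₊
    have hB' : C * (⌊x⌋₊ : ℝ) ^ κ ≤ C * x ^ κ :=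
      mul_le_mul_of_nonneg_left (Real.rpow_le_rpow (Nat.cast_nonneg _) hfl hκ.le) hC
    have hD : ‖charMean χ * ((x - ⌊x⌋₊ : ℝ) : ℂ)‖ ≤ 1 := by
      rw [norm_mul, Complex.norm_real, Real.norm_of_nonneg (by linarith)]
      exact mul_le_one₀ (norm_charMean_le χ) (by linarith) (by linarith)
    rw [hdec]
    refine (norm_sub_le _ _).trans ?_
    have h4 := norm_sub_le (∑ k ∈ Finset.Icc 1 ⌊x⌋₊, χ ((k : ℕ) : ZMod q) - charMean χ * (⌊x⌋₊ : ℕ))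
      (∑ k ∈ Finset.Icc 1 ⌊x⌋₊, (χ ((k : ℕ) : ZMod q) - roughCoeff χ y k))
    have h5 : 0 ≤ (q : ℝ) := Nat.cast_nonneg _
    nlinarith [mul_nonneg h5 (by linarith : 0 ≤ x ^ κ - 1)]

lemma measurable_sumError (y : ℕ) : Measurable (sumError χ y) := by
  unfold sumError
  refine Measurable.sub ?_ (by fun_prop)
  exact (measurable_from_nat (f := fun n => ∑ k ∈ Finset.Icc 1 n, roughCoeff χ y k)).comp
    Nat.measurable_floor

lemma norm_sumError_le_two_mul_abs (y : ℕ) (x : ℝ) : ‖sumError χ y x‖ ≤ 2 * |x| := by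
  have h1 : ‖∑ k ∈ Finset.Icc 1 ⌊x⌋₊, roughCoeff χ y k‖ ≤ |x| := by
    calc _ ≤ ∑ k ∈ Finset.Icc 1 ⌊x⌋₊, ‖roughCoeff χ y k‖ := norm_sum_le _ _
      _ ≤ ∑ k ∈ Finset.Icc 1 ⌊x⌋₊, (1 : ℝ) := Finset.sum_le_sum fun k _ => norm_roughCoeff_le χ y k
      _ = ⌊x⌋₊ := by simp
      _ ≤ ⌊|x|⌋₊ := by exact_mod_cast Nat.floor_mono (le_abs_self x)
      _ ≤ |x| := Nat.floor_le (abs_nonneg x)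
  have h2 : ‖charMean χ * (x : ℂ)‖ ≤ |x| := by
    rw [norm_mul, Complex.norm_real, Real.norm_eq_abs]
    exact mul_le_of_le_one_left (abs_nonneg x) (norm_charMean_le χ)
  rw [sumError]
  exact (norm_sub_le _ _).trans (by linarith)

open MeasureTheory in
lemma locallyIntegrable_sumError (y : ℕ) : LocallyIntegrable (sumError χ y) := by
  have h : LocallyIntegrable (fun x : ℝ => 2 * |x|) :=
    (by fun_prop : Continuous _).locallyIntegrable
  refine h.mono (measurable_sumError χ y).aestronglyMeasurable (.of_forall fun x => ?_)
  simpa using norm_sumError_le_two_mul_abs χ y x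

end Coefficients

/-! ### Analytic continuation as a Mellin transform -/

section Continuation

variable {q : ℕ} (χ : DirichletCharacter ℂ q)

lemma eulerProd_zero_eq (y : ℕ) {s : ℂ} (hs : s ≠ 0) :
    eulerProd (primesUpTo y) s (fun _ => 0) χ
      = ∏ p ∈ (y + 1).primesBelow, (1 - dirichletSummandHom χ hs p)⁻¹ := by
  have : primesUpTo y = (y + 1).primesBelow := rfl
  rw [eulerProd, this]
  refine Finset.prod_congr rfl fun p _ => ?_
  simp [eAdd, dirichletSummandHom, Complex.cpow_neg, div_eq_mul_inv]

lemma one_sub_dirichletSummand_ne_zero {p : ℕ} (hp : p.Prime) {s : ℂ} (hs : 0 < s.re) :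
    1 - χ (p : ZMod q) / (p : ℂ) ^ s ≠ 0 := by
  intro h
  have h1 : ‖χ (p : ZMod q) / (p : ℂ) ^ s‖ < 1 := by
    rw [norm_div, Complex.norm_natCast_cpow_of_pos hp.pos]
    have : 1 < (p : ℝ) ^ s.re := Real.one_lt_rpow (by exact_mod_cast hp.one_lt) hs
    rw [div_lt_one (by linarith)]
    exact (χ.norm_le_one _).trans_lt this
  rw [← sub_eq_zero.mp h] at h1
  simp at h1

variable [NeZero q]

lemma differentiableAt_eulerTail (y : ℕ) {s : ℂ} (hs : 0 < s.re) (hs1 : s ≠ 1) :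
    DifferentiableAt ℂ (eulerTail χ y) s := by
  unfold eulerTail eulerProd
  refine (χ.differentiableAt_LFunction s (.inl hs1)).sub ?_
  refine DifferentiableAt.fun_finsetProd fun p hp => ?_
  have hp' : p.Prime := (Finset.mem_filter.mp hp).2
  have hp0 : (p : ℂ) ≠ 0 := by exact_mod_cast hp'.ne_zero
  have h1 := one_sub_dirichletSummand_ne_zero χ hp' hs
  have h2 : (p : ℂ) ^ s ≠ 0 := by simp [Complex.cpow_eq_zero_iff, hp0]
  refine DifferentiableAt.fun_inv ?_ (by simpa [eAdd] using h1)
  refine (differentiableAt_const _).sub ((differentiableAt_const _).div ?_ h2)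
  exact (differentiableAt_id).const_cpow (.inl hp0)

lemma eulerTail_eq_LSeries (y : ℕ) {s : ℂ} (hs : 1 < s.re) :
    eulerTail χ y s = LSeries (roughCoeff χ y) s := by
  have hs0 : s ≠ 0 := Complex.ne_zero_of_one_lt_re hs
  have hsum := (summable_dirichletSummand χ hs).of_norm
  rw [eulerTail, eulerProd_zero_eq χ y hs0, χ.LFunction_eq_LSeries hs]
  have h1 := EulerProduct.prod_primesBelow_geometric_eq_tsum_smoothNumbers
    (f := (dirichletSummandHom χ hs0 : ℕ →* ℂ)) hsum (y + 1)
  simp only [MonoidHom.coe_coe] at h1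
  rw [h1, ← tsum_dirichletSummand χ hs, tsum_subtype ((y + 1).smoothNumbers)
    (fun n => dirichletSummandHom χ hs0 n), ← hsum.tsum_sub (hsum.indicator _), LSeries]
  refine tsum_congr fun n => ?_
  by_cases h : n ∈ (y + 1).smoothNumbers
  · simp [h, roughCoeff, LSeries.term_def]
  · rcases eq_or_ne n 0 with rfl | hn
    · simp [h]
    · simp [h, hn, roughCoeff, dirichletSummandHom, LSeries.term_of_ne_zero, Complex.cpow_neg,
        div_eq_mul_inv]

/-- The part of `sumError` on `(1, ∞)`, whose Mellin transform gives the continuation of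
`eulerTail` across the line `re s = 1`. -/
noncomputable def sumErrorTop (y : ℕ) : ℝ → ℂ := Set.indicator (Set.Ioi 1) (sumError χ y)

open MeasureTheory in
lemma integral_sumErrorTop (y : ℕ) (s : ℂ) :
    mellin (sumErrorTop χ y) (-s)
      = ∫ t in Set.Ioi (1 : ℝ), (t : ℂ) ^ (-s - 1) * sumError χ y t := by
  have : ∀ t : ℝ, (t : ℂ) ^ (-s - 1) • sumErrorTop χ y t
      = Set.indicator (Set.Ioi 1) (fun t : ℝ => (t : ℂ) ^ (-s - 1) * sumError χ y t) t := by
    intro t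
    by_cases h : t ∈ Set.Ioi (1 : ℝ) <;> simp [sumErrorTop, h]
  simp only [mellin, this]
  rw [setIntegral_indicator measurableSet_Ioi]
  congr 2
  ext t; simp only [Set.mem_inter_iff, Set.mem_Ioi, and_iff_right_iff_imp]; intro h; linarith

open Asymptotics Filter in
lemma sumError_isBigO_atTop (y : ℕ) {κ : ℝ} (hκ : 0 < κ) (hκ1 : κ ≤ 1) :
    sumError χ y =O[atTop] (fun x : ℝ => x ^ (-(-κ))) := by
  obtain ⟨C, -, hC⟩ := exists_norm_sumError_le χ y hκ hκ1
  refine IsBigO.of_bound C ?_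
  filter_upwards [eventually_gt_atTop 0] with x hx
  rw [Real.norm_of_nonneg (Real.rpow_nonneg hx.le _), neg_neg]
  exact hC x hx

open Asymptotics Filter Topology in
lemma sumErrorTop_isBigO_atTop (y : ℕ) {κ : ℝ} (hκ : 0 < κ) (hκ1 : κ ≤ 1) :
    sumErrorTop χ y =O[atTop] (fun x : ℝ => x ^ (-(-κ))) := by
  refine (sumError_isBigO_atTop χ y hκ hκ1).congr' ?_ .rfl
  filter_upwards [eventually_gt_atTop 1] with x hx
  simp [sumErrorTop, hx]

open Asymptotics Filter Topology in
lemma sumErrorTop_isBigO_zero (y : ℕ) (b : ℝ) :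
    sumErrorTop χ y =O[𝓝[>] 0] (fun x : ℝ => x ^ (-b)) := by
  refine (isBigO_zero _ _).congr' ?_ .rfl
  filter_upwards [mem_nhdsWithin_of_mem_nhds (Iio_mem_nhds (zero_lt_one' ℝ))] with x hx
  simp only [Set.mem_Iio] at hx
  simp [sumErrorTop, hx.le]

lemma locallyIntegrable_sumErrorTop (y : ℕ) :
    MeasureTheory.LocallyIntegrable (sumErrorTop χ y) :=
  (locallyIntegrable_sumError χ y).indicator measurableSet_Ioi

lemma mellinConvergent_sumErrorTop (y : ℕ) {κ : ℝ} (hκ : 0 < κ) (hκ1 : κ ≤ 1) {s : ℂ}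
    (hs : κ < s.re) : MellinConvergent (sumErrorTop χ y) (-s) :=
  mellinConvergent_of_isBigO_rpow (b := -s.re - 1)
    ((locallyIntegrable_sumErrorTop χ y).locallyIntegrableOn _)
    (sumErrorTop_isBigO_atTop χ y hκ hκ1) (by simpa using hs) (sumErrorTop_isBigO_zero χ y _)
    (by simp)

lemma differentiableAt_mellin_sumErrorTop (y : ℕ) {κ : ℝ} (hκ : 0 < κ) (hκ1 : κ ≤ 1) {s : ℂ}
    (hs : κ < s.re) : DifferentiableAt ℂ (fun s => mellin (sumErrorTop χ y) (-s)) s := by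
  have h : DifferentiableAt ℂ (mellin (sumErrorTop χ y)) (-s) :=
    mellin_differentiableAt_of_isBigO_rpow (b := -s.re - 1)
      ((locallyIntegrable_sumErrorTop χ y).locallyIntegrableOn _)
      (sumErrorTop_isBigO_atTop χ y hκ hκ1) (by simpa using hs) (sumErrorTop_isBigO_zero χ y _)
      (by simp)
  exact h.comp s differentiable_neg.differentiableAt

open Asymptotics Filter MeasureTheory in
lemma eulerTail_eq_of_one_lt_re (y : ℕ) {s : ℂ} (hs : 1 < s.re) :
    eulerTail χ y s = s * mellin (sumErrorTop χ y) (-s) + charMean χ * (s / (s - 1)) := by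
  have hs1 : s - 1 ≠ 0 := by
    intro h; rw [sub_eq_zero.mp h] at hs; simp at hs
  have hO : (fun n => ∑ k ∈ Finset.Icc 1 n, roughCoeff χ y k) =O[atTop]
      fun n : ℕ => (n : ℝ) ^ (1 : ℝ) := by
    refine IsBigO.of_bound 1 (.of_forall fun n => ?_)
    calc ‖∑ k ∈ Finset.Icc 1 n, roughCoeff χ y k‖
        ≤ ∑ k ∈ Finset.Icc 1 n, ‖roughCoeff χ y k‖ := norm_sum_le _ _
      _ ≤ ∑ k ∈ Finset.Icc 1 n, (1 : ℝ) := Finset.sum_le_sum fun k _ => norm_roughCoeff_le χ y k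
      _ = 1 * ‖(n : ℝ) ^ (1 : ℝ)‖ := by simp
  have hS : LSeriesSummable (roughCoeff χ y) s :=
    LSeriesSummable_of_bounded_of_one_lt_re (m := 1) (fun n _ => norm_roughCoeff_le χ y n) hs
  rw [eulerTail_eq_LSeries χ y hs, LSeries_eq_mul_integral _ zero_le_one hs hS hO,
    integral_sumErrorTop]
  have hre : (-s).re < -1 := by simpa using hs
  have hint : IntegrableOn (fun t : ℝ => charMean χ * (t : ℂ) ^ (-s)) (Set.Ioi 1) :=
    (integrableOn_Ioi_cpow_of_lt hre zero_lt_one).const_mul _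
  have hconv := mellinConvergent_sumErrorTop χ y (κ := 1) one_pos le_rfl hs
  have hint' : IntegrableOn (fun t : ℝ => (t : ℂ) ^ (-s - 1) * sumError χ y t) (Set.Ioi 1) := by
    refine (hconv.mono_set (Set.Ioi_subset_Ioi zero_le_one)).congr_fun (fun t ht => ?_)
      measurableSet_Ioi
    simp only [sumErrorTop, Set.indicator_of_mem ht, smul_eq_mul]
  have hsplit : ∫ t in Set.Ioi (1 : ℝ), (∑ k ∈ Finset.Icc 1 ⌊t⌋₊, roughCoeff χ y k)
        * (t : ℂ) ^ (-(s + 1))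
      = (∫ t in Set.Ioi (1 : ℝ), (t : ℂ) ^ (-s - 1) * sumError χ y t)
        + ∫ t in Set.Ioi (1 : ℝ), charMean χ * (t : ℂ) ^ (-s) := by
    rw [← integral_add hint' hint]
    refine setIntegral_congr_fun measurableSet_Ioi fun t ht => ?_
    have ht0 : (t : ℂ) ≠ 0 := by
      exact_mod_cast (lt_trans zero_lt_one (Set.mem_Ioi.mp ht)).ne'
    have hpow : (t : ℂ) ^ (-s) = (t : ℂ) ^ (-s - 1) * t := by
      have := Complex.cpow_add (-s - 1) 1 ht0
      rwa [Complex.cpow_one, sub_add_cancel] at this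
    simp only [sumError, show -(s + 1) = -s - 1 by ring, hpow]
    ring
  rw [hsplit, integral_const_mul, integral_Ioi_cpow_of_lt hre zero_lt_one]
  have : -s + 1 ≠ 0 := by intro h; exact hs1 (by linear_combination -h)
  simp
  field_simp
  ring

/-- The identity of `eulerTail_eq_of_one_lt_re` persists to the left of `re s = 1` by the identity
theorem, applied in the open upper and lower quadrants so as to avoid the pole at `s = 1`. -/
lemma eulerTail_eq_of_lt_re (y : ℕ) {κ : ℝ} (hκ : 0 < κ) (hκ1 : κ ≤ 1) {s : ℂ} (hs : κ < s.re)
    (him : s.im ≠ 0) :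
    eulerTail χ y s = s * mellin (sumErrorTop χ y) (-s) + charMean χ * (s / (s - 1)) := by
  have aux : ∀ U : Set ℂ, IsOpen U → Convex ℝ U → (∀ z ∈ U, κ < z.re ∧ z.im ≠ 0) →
      ∀ z₀ ∈ U, 1 < z₀.re → Set.EqOn (eulerTail χ y)
        (fun s => s * mellin (sumErrorTop χ y) (-s) + charMean χ * (s / (s - 1))) U := by
    intro U hU hUc hUk z₀ hz₀ hz₀1
    have hne : ∀ z ∈ U, z ≠ 1 := fun z hz h => (hUk z hz).2 (by simp [h])
    refine AnalyticOnNhd.eqOn_of_preconnected_of_eventuallyEq (𝕜 := ℂ) (z₀ := z₀)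
      (DifferentiableOn.analyticOnNhd (fun z hz => ?_) hU)
      (DifferentiableOn.analyticOnNhd (fun z hz => ?_) hU) hUc.isPreconnected hz₀ ?_
    · exact (differentiableAt_eulerTail χ y (hκ.trans (hUk z hz).1)
        (hne z hz)).differentiableWithinAt
    · have h1 := differentiableAt_mellin_sumErrorTop χ y hκ hκ1 (hUk z hz).1
      have h2 : z - 1 ≠ 0 := sub_ne_zero.mpr (hne z hz)
      refine ((differentiableAt_id.mul h1).add ((differentiableAt_const _).mul
        (differentiableAt_id.div (differentiableAt_id.sub_const 1) h2))).differentiableWithinAt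
    · filter_upwards [(isOpen_lt continuous_const Complex.continuous_re).mem_nhds hz₀1] with z hz
      exact eulerTail_eq_of_one_lt_re χ y hz
  rcases lt_or_gt_of_ne him with h | h
  · exact aux ({z | κ < z.re} ∩ {z | z.im < 0})
      ((isOpen_lt continuous_const Complex.continuous_re).inter
        (isOpen_lt Complex.continuous_im continuous_const))
      ((convex_halfSpace_re_gt κ).inter (convex_halfSpace_im_lt 0))
      (fun z hz => ⟨hz.1, hz.2.ne⟩) ⟨2, -1⟩ ⟨by simp; linarith, by simp⟩ (by simp) ⟨hs, h⟩
  · exact aux ({z | κ < z.re} ∩ {z | 0 < z.im})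
      ((isOpen_lt continuous_const Complex.continuous_re).inter
        (isOpen_lt continuous_const Complex.continuous_im))
      ((convex_halfSpace_re_gt κ).inter (convex_halfSpace_im_gt 0))
      (fun z hz => ⟨hz.1, hz.2.ne'⟩) ⟨2, 1⟩ ⟨by simp; linarith, by simp⟩ (by simp) ⟨hs, h⟩

open Asymptotics Filter Topology in
lemma mellinConvergent_sumError (y : ℕ) {κ : ℝ} (hκ : 0 < κ) (hκ1 : κ ≤ 1) {s : ℂ}
    (hs : κ < s.re) (hs1 : s.re < 1) : MellinConvergent (sumError χ y) (-s) := by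
  refine mellinConvergent_of_isBigO_rpow (b := -1)
    ((locallyIntegrable_sumError χ y).locallyIntegrableOn _)
    (sumError_isBigO_atTop χ y hκ hκ1) (by simpa using hs) ?_ (by simpa using hs1)
  refine IsBigO.of_bound 1 ?_
  filter_upwards [self_mem_nhdsWithin,
    mem_nhdsWithin_of_mem_nhds (Iio_mem_nhds (zero_lt_one' ℝ))] with x hx hx1
  simp only [Set.mem_Iio, Set.mem_Ioi] at hx hx1
  simpa [abs_of_pos hx] using norm_sumError_le_of_lt_one χ y hx.le hx1

/-- In the strip `κ < re s < 1` the pole term at `s = 1` is absorbed by the Mellin integral over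
`(0, 1)`. -/
lemma mul_mellin_sumError (y : ℕ) {κ : ℝ} (hκ : 0 < κ) (hκ1 : κ ≤ 1) {s : ℂ}
    (hs : κ < s.re) (hs1 : s.re < 1) (him : s.im ≠ 0) :
    s * mellin (sumError χ y) (-s) = eulerTail χ y s := by
  have h1 := hasMellin_cpow_Ioc 1 (s := -s) (by simpa using hs1)
  have h2 := hasMellin_const_smul h1.1 (charMean χ)
  have h3 := hasMellin_sub (mellinConvergent_sumErrorTop χ y hκ hκ1 hs) h2.1
  have h4 : mellin (sumError χ y) (-s) = mellin (fun t => sumErrorTop χ y t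
      - charMean χ • Set.indicator (Set.Ioc 0 1) (fun t : ℝ => (t : ℂ) ^ (1 : ℂ)) t) (-s) := by
    refine MeasureTheory.setIntegral_congr_fun measurableSet_Ioi fun t ht => ?_
    have ht0 : 0 < t := ht
    simp only [sumErrorTop]
    rcases lt_trichotomy t 1 with h | h | h
    · simp [h.not_gt, h.le, ht0, sumError_of_lt_one χ y h]
    · have : (1 : ℕ) ∈ (y + 1).smoothNumbers := by simp [Nat.mem_smoothNumbers]
      simp [h, sumError, roughCoeff, this]
    · simp [h, h.not_ge]
  have hne : s - 1 ≠ 0 := by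
    intro h; rw [sub_eq_zero.mp h] at him; simp at him
  have hne' : -s + 1 ≠ 0 := by intro h; exact hne (by linear_combination -h)
  rw [h4, h3.2, h2.2, h1.2, eulerTail_eq_of_lt_re χ y hκ hκ1 hs him, smul_eq_mul]
  field_simp
  ring

end Continuation

/-! ### Mean square of the short window increments -/

section MeanSquare

variable {q : ℕ} [NeZero q] (χ : DirichletCharacter ℂ q)

/-- The increment of `sumError` over the short multiplicative window `(x, e^h x]`. -/
noncomputable def windowError (y : ℕ) (h x : ℝ) : ℂ :=
  sumError χ y (Real.exp h * x) - sumError χ y x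

/-- The increment `windowError` in the logarithmic variable `x = e^{-u}`, weighted by `x^{-σ}`. -/
noncomputable def windowProfile (y : ℕ) (h σ u : ℝ) : ℂ :=
  Real.exp (σ * u) • windowError χ y h (Real.exp (-u))

open FourierTransform in
/-- The Dirichlet series on the line `re s = σ` is, up to an explicit factor, the Fourier transform
of the window increments. -/
lemma fourier_windowProfile (y : ℕ) (h : ℝ) {κ : ℝ} (hκ : 0 < κ) (hκ1 : κ ≤ 1) {s : ℂ}
    (hs : κ < s.re) (hs1 : s.re < 1) (him : s.im ≠ 0) :
    s * 𝓕 (windowProfile χ y h s.re) (-(s.im / (2 * Real.pi)))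
      = (Complex.exp (h * s) - 1) * eulerTail χ y s := by
  have h1 := mellinConvergent_sumError χ y hκ hκ1 hs hs1
  have hpos := Real.exp_pos h
  have h3 := hasMellin_sub ((MellinConvergent.comp_mul_left hpos).mpr h1) h1
  have h4 := mellin_eq_fourier (windowError χ y h) (s := -s)
  have h5 : 𝓕 (windowProfile χ y h s.re) (-(s.im / (2 * Real.pi)))
      = mellin (windowError χ y h) (-s) := by
    rw [h4]
    simp only [Complex.neg_re, neg_neg, Complex.neg_im, neg_div]
    rfl
  rw [h5]
  unfold windowError
  rw [h3.2, mellin_comp_mul_left _ _ hpos, ← mul_mellin_sumError χ y hκ hκ1 hs hs1 him, neg_neg,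
    Complex.cpow_def_of_ne_zero (by exact_mod_cast hpos.ne'), ← Complex.ofReal_log hpos.le,
    Real.log_exp, smul_eq_mul]
  ring

lemma measurable_windowError (y : ℕ) (h : ℝ) : Measurable (windowError χ y h) := by
  unfold windowError
  exact ((measurable_sumError χ y).comp (by fun_prop)).sub (measurable_sumError χ y)

lemma measurable_windowProfile (y : ℕ) (h σ : ℝ) : Measurable (windowProfile χ y h σ) := by
  unfold windowProfile
  have h1 : Measurable fun u : ℝ => Real.exp (σ * u) := by fun_prop
  have h2 : Measurable fun u : ℝ => Real.exp (-u) := by fun_prop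
  exact h1.smul ((measurable_windowError χ y h).comp h2)

lemma exp_le_three {h : ℝ} (h1 : h ≤ 1) : Real.exp h ≤ 3 :=
  (Real.exp_le_exp.mpr h1).trans (by linarith [Real.exp_one_lt_d9])

lemma norm_windowError_le_mul (y : ℕ) {h x : ℝ} (h1 : h ≤ 1) (hx : 0 < x) :
    ‖windowError χ y h x‖ ≤ 8 * x := by
  have hpos := Real.exp_pos h
  have h2 := norm_sumError_le_two_mul_abs χ y (Real.exp h * x)
  have h3 := norm_sumError_le_two_mul_abs χ y x
  rw [abs_of_pos (by positivity)] at h2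
  rw [abs_of_pos hx] at h3
  have := mul_le_mul_of_nonneg_right (exp_le_three h1) hx.le
  exact (norm_sub_le _ _).trans (by linarith)

lemma exists_norm_windowError_le_rpow (y : ℕ) {κ : ℝ} (hκ : 0 < κ) (hκ1 : κ ≤ 1) :
    ∃ C : ℝ, 0 ≤ C ∧ ∀ h x : ℝ, h ≤ 1 → 0 < x → ‖windowError χ y h x‖ ≤ C * x ^ κ := by
  obtain ⟨C, hC, hCx⟩ := exists_norm_sumError_le χ y hκ hκ1
  refine ⟨4 * C, by positivity, fun h x h1 hx => ?_⟩
  have hpos := Real.exp_pos h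
  have h2 := hCx (Real.exp h * x) (by positivity)
  have h3 := hCx x hx
  have hxκ : 0 ≤ x ^ κ := by positivity
  have h4 : (Real.exp h * x) ^ κ ≤ 3 * x ^ κ := by
    rw [Real.mul_rpow hpos.le hx.le]
    refine mul_le_mul_of_nonneg_right ?_ hxκ
    calc Real.exp h ^ κ ≤ 3 ^ κ := Real.rpow_le_rpow hpos.le (exp_le_three h1) hκ.le
      _ ≤ 3 ^ (1 : ℝ) := Real.rpow_le_rpow_of_exponent_le (by norm_num) hκ1
      _ = 3 := by simp
  have h5 := mul_le_mul_of_nonneg_left h4 hC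
  exact (norm_sub_le _ _).trans (by linarith)

lemma norm_windowProfile (y : ℕ) (h σ u : ℝ) :
    ‖windowProfile χ y h σ u‖ = Real.exp (σ * u) * ‖windowError χ y h (Real.exp (-u))‖ := by
  rw [windowProfile, norm_smul, Real.norm_of_nonneg (Real.exp_pos _).le]

/-- The window increments decay exponentially in the logarithmic variable at both ends. -/
lemma exists_norm_windowProfile_le (y : ℕ) {h σ κ : ℝ} (h1 : h ≤ 1) (hκ : 0 < κ) (hσ : κ < σ)
    (hσ1 : σ < 1) :
    ∃ C μ : ℝ, 0 ≤ C ∧ 0 < μ ∧ ∀ u, ‖windowProfile χ y h σ u‖ ≤ C * Real.exp (-μ * |u|) := by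
  obtain ⟨C, hC, hCx⟩ := exists_norm_windowError_le_rpow χ y hκ (hσ.trans hσ1).le
  refine ⟨8 + C, min (1 - σ) (σ - κ), by positivity, lt_min (by linarith) (by linarith),
    fun u => ?_⟩
  rw [norm_windowProfile]
  set μ := min (1 - σ) (σ - κ)
  have hpos := Real.exp_pos (-u)
  rcases le_total 0 u with hu | hu
  · calc Real.exp (σ * u) * ‖windowError χ y h (Real.exp (-u))‖
        ≤ Real.exp (σ * u) * (8 * Real.exp (-u)) :=
          mul_le_mul_of_nonneg_left (norm_windowError_le_mul χ y h1 hpos) (Real.exp_pos _).le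
      _ = 8 * Real.exp (-(1 - σ) * u) := by
          rw [mul_left_comm, ← Real.exp_add]; ring_nf
      _ ≤ 8 * Real.exp (-μ * |u|) := by
          rw [abs_of_nonneg hu]
          have : μ ≤ 1 - σ := min_le_left _ _
          gcongr
      _ ≤ _ := by gcongr; linarith
  · calc Real.exp (σ * u) * ‖windowError χ y h (Real.exp (-u))‖
        ≤ Real.exp (σ * u) * (C * Real.exp (-u) ^ κ) :=
          mul_le_mul_of_nonneg_left (hCx h _ h1 hpos) (Real.exp_pos _).le
      _ = C * Real.exp ((σ - κ) * u) := by
          rw [← Real.exp_mul, mul_left_comm, ← Real.exp_add]; ring_nf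
      _ ≤ C * Real.exp (-μ * |u|) := by
          rw [abs_of_nonpos hu]
          have : μ ≤ σ - κ := min_le_right _ _
          gcongr C * Real.exp ?_
          nlinarith
      _ ≤ _ := by gcongr; linarith

open MeasureTheory in
lemma integrable_exp_neg_mul_abs {μ : ℝ} (hμ : 0 < μ) :
    Integrable (fun u : ℝ => Real.exp (-μ * |u|)) := by
  rw [← integrableOn_univ, ← Set.Iic_union_Ioi (a := (0 : ℝ)), integrableOn_union]
  constructor
  · refine (integrableOn_exp_mul_Iic hμ 0).congr_fun (fun u hu => ?_) measurableSet_Iic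
    simp only [abs_of_nonpos (Set.mem_Iic.mp hu)]; ring_nf
  · refine (integrableOn_exp_mul_Ioi (neg_lt_zero.mpr hμ) 0).congr_fun (fun u hu => ?_)
      measurableSet_Ioi
    simp only [abs_of_pos (Set.mem_Ioi.mp hu)]

open MeasureTheory in
lemma integrable_windowProfile (y : ℕ) {h σ κ : ℝ} (h1 : h ≤ 1) (hκ : 0 < κ) (hσ : κ < σ)
    (hσ1 : σ < 1) : Integrable (windowProfile χ y h σ) := by
  obtain ⟨C, μ, hC, hμ, hb⟩ := exists_norm_windowProfile_le χ y h1 hκ hσ hσ1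
  exact ((integrable_exp_neg_mul_abs hμ).const_mul C).mono'
    (measurable_windowProfile χ y h σ).aestronglyMeasurable (.of_forall hb)

open MeasureTheory in
lemma memLp_two_windowProfile (y : ℕ) {h σ κ : ℝ} (h1 : h ≤ 1) (hκ : 0 < κ) (hσ : κ < σ)
    (hσ1 : σ < 1) : MemLp (windowProfile χ y h σ) 2 := by
  obtain ⟨C, μ, hC, hμ, hb⟩ := exists_norm_windowProfile_le χ y h1 hκ hσ hσ1
  have hm := (measurable_windowProfile χ y h σ).aestronglyMeasurable (μ := volume)
  rw [memLp_two_iff_integrable_sq_norm hm]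
  refine ((integrable_exp_neg_mul_abs (μ := 2 * μ) (by positivity)).const_mul (C ^ 2)).mono'
    (hm.norm.pow 2) (.of_forall fun u => ?_)
  rw [norm_pow, norm_norm]
  calc _ ≤ (C * Real.exp (-μ * |u|)) ^ 2 := pow_le_pow_left₀ (norm_nonneg _) (hb u) 2
    _ = _ := by rw [mul_pow, ← Real.exp_nat_mul]; ring_nf

/-- A window `(x, e^h x]` with `x ≤ 1 / (4h)` contains at most one integer. -/
lemma norm_windowError_le_of_short (y : ℕ) {h x : ℝ} (h0 : 0 < h) (h1 : h ≤ 1) (hx : 0 < x)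
    (hxh : x ≤ 1 / (4 * h)) :
    ‖windowError χ y h x‖ ≤ 2 * h * x ∨
      ∃ n : ℕ, y < n ∧ x < n ∧ n ≤ Real.exp h * x ∧ ‖windowError χ y h x‖ ≤ 1 + 2 * h * x := by
  have hexp : Real.exp h - 1 ≤ 2 * h := by
    have := Real.abs_exp_sub_one_le (x := h) (by rw [abs_of_pos h0]; exact h1)
    rw [abs_of_pos h0] at this
    exact (le_abs_self _).trans this
  have hlen : 2 * h * x ≤ 1 / 2 := by
    rw [le_div_iff₀ (by positivity)] at hxh
    linarith
  have hmain : ‖charMean χ * ((Real.exp h * x - x : ℝ) : ℂ)‖ ≤ 2 * h * x := by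
    have hge : 0 ≤ Real.exp h * x - x := by
      have := Real.add_one_le_exp h
      nlinarith
    rw [norm_mul, Complex.norm_real, Real.norm_of_nonneg hge]
    refine (mul_le_of_le_one_left hge (norm_charMean_le χ)).trans ?_
    nlinarith
  have hdec : windowError χ y h x
      = (∑ k ∈ Finset.Icc 1 ⌊Real.exp h * x⌋₊, roughCoeff χ y k
          - ∑ k ∈ Finset.Icc 1 ⌊x⌋₊, roughCoeff χ y k)
        - charMean χ * ((Real.exp h * x - x : ℝ) : ℂ) := by
    simp only [windowError, sumError]
    push_cast
    ring
  have hle : x ≤ Real.exp h * x := le_mul_of_one_le_left hx.le (Real.one_le_exp h0.le)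
  have hfl : ⌊x⌋₊ ≤ ⌊Real.exp h * x⌋₊ := Nat.floor_mono hle
  have hfl' : ⌊Real.exp h * x⌋₊ ≤ ⌊x⌋₊ + 1 := by
    rw [← Nat.floor_add_one hx.le]
    exact Nat.floor_mono (by nlinarith)
  rcases Nat.lt_or_ge ⌊x⌋₊ ⌊Real.exp h * x⌋₊ with hlt | hge
  · have heq : ⌊Real.exp h * x⌋₊ = ⌊x⌋₊ + 1 := le_antisymm hfl' hlt
    rw [heq, Finset.sum_Icc_succ_top (by omega), add_sub_cancel_left] at hdec
    rcases Nat.lt_or_ge y (⌊x⌋₊ + 1) with hy | hy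
    · refine Or.inr ⟨⌊x⌋₊ + 1, hy, by exact_mod_cast Nat.lt_floor_add_one x, ?_, ?_⟩
      · rw [← heq]; exact Nat.floor_le (by positivity)
      · rw [hdec]
        exact (norm_sub_le _ _).trans (add_le_add (norm_roughCoeff_le χ y _) hmain)
    · left
      rw [hdec, roughCoeff_eq_zero χ (by omega) hy, zero_sub, norm_neg]
      exact hmain
  · left
    rw [hdec, le_antisymm hge hfl, sub_self, zero_sub, norm_neg]
    exact hmain

lemma enorm_windowProfile_sq (y : ℕ) (h σ u : ℝ) :
    ‖windowProfile χ y h σ u‖ₑ ^ 2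
      = ENNReal.ofReal (Real.exp (2 * σ * u) * ‖windowError χ y h (Real.exp (-u))‖ ^ 2) := by
  rw [← ofReal_norm, ← ENNReal.ofReal_pow (norm_nonneg _), norm_windowProfile, mul_pow,
    ← Real.exp_nat_mul]
  congr 3
  push_cast; ring

/-- The pointwise majorant of the window increments: integers in short windows, the linear term in
short windows, and the crude bound in long windows. The second indicator starts at
`log (4h) - 1` only so that the half-line `u ≥ log (4h)` lies in an open one. -/
lemma enorm_windowProfile_sq_le (y : ℕ) {h σ κ C : ℝ} (h0 : 0 < h) (h1 : h ≤ 1)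
    (hCx : ∀ x : ℝ, 0 < x → ‖windowError χ y h x‖ ≤ C * x ^ κ) (u : ℝ) :
    ‖windowProfile χ y h σ u‖ₑ ^ 2 ≤
      (∑' n : ℕ, Set.indicator (Set.Ioc (-Real.log n) (h - Real.log n))
        (fun u => if y < n then ENNReal.ofReal (2 * Real.exp (2 * σ * u)) else 0) u)
      + Set.indicator (Set.Ioi (Real.log (4 * h) - 1))
          (fun u => ENNReal.ofReal (8 * h ^ 2 * Real.exp (-(2 * (1 - σ)) * u))) u
      + Set.indicator (Set.Iic (Real.log (4 * h)))
          (fun u => ENNReal.ofReal (C ^ 2 * Real.exp (2 * (σ - κ) * u))) u := by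
  rw [enorm_windowProfile_sq]
  have hx := Real.exp_pos (-u)
  rcases le_total u (Real.log (4 * h)) with hu | hu
  · refine le_add_left ?_
    rw [Set.indicator_of_mem (Set.mem_Iic.mpr hu)]
    refine ENNReal.ofReal_le_ofReal ?_
    calc _ ≤ Real.exp (2 * σ * u) * (C * Real.exp (-u) ^ κ) ^ 2 := by
          gcongr; exact hCx _ hx
      _ = _ := by
          rw [← Real.exp_mul, mul_pow, ← Real.exp_nat_mul, mul_left_comm, ← Real.exp_add]
          push_cast; ring_nf
  · refine le_add_right ?_
    rw [Set.indicator_of_mem (Set.mem_Ioi.mpr (by linarith))]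
    have hxh : Real.exp (-u) ≤ 1 / (4 * h) := by
      rw [one_div, Real.exp_neg, ← Real.exp_log (by positivity : 0 < 4 * h)]
      gcongr
    have hlin : Real.exp (2 * σ * u) * (8 * h ^ 2 * Real.exp (-u) ^ 2)
        = 8 * h ^ 2 * Real.exp (-(2 * (1 - σ)) * u) := by
      rw [← Real.exp_nat_mul, mul_left_comm, ← Real.exp_add]
      push_cast; ring_nf
    rcases norm_windowError_le_of_short χ y h0 h1 hx hxh with hs | ⟨n, hyn, hxn, hnx, hs⟩
    · refine le_add_left (ENNReal.ofReal_le_ofReal ?_)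
      rw [← hlin]
      gcongr
      have : ‖windowError χ y h (Real.exp (-u))‖ ^ 2 ≤ (2 * h * Real.exp (-u)) ^ 2 := by
        gcongr
      nlinarith [sq_nonneg (h * Real.exp (-u))]
    · have hn0 : (0 : ℝ) < n := hx.trans hxn
      have hmem : u ∈ Set.Ioc (-Real.log n) (h - Real.log n) := by
        constructor
        · have := (Real.lt_log_iff_exp_lt hn0).mpr hxn
          linarith
        · rw [← Real.exp_add] at hnx
          have := (Real.log_le_iff_le_exp hn0).mpr hnx
          linarith
      calc _ ≤ ENNReal.ofReal (2 * Real.exp (2 * σ * u)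
            + 8 * h ^ 2 * Real.exp (-(2 * (1 - σ)) * u)) := by
            refine ENNReal.ofReal_le_ofReal ?_
            rw [← hlin]
            have h2 : ‖windowError χ y h (Real.exp (-u))‖ ^ 2
                ≤ (1 + 2 * h * Real.exp (-u)) ^ 2 := by
              gcongr
            have h3 : ‖windowError χ y h (Real.exp (-u))‖ ^ 2
                ≤ 2 + 8 * h ^ 2 * Real.exp (-u) ^ 2 := by
              nlinarith [sq_nonneg (1 - 2 * h * Real.exp (-u))]
            linarith [mul_le_mul_of_nonneg_left h3 (Real.exp_pos (2 * σ * u)).le]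
        _ = ENNReal.ofReal (2 * Real.exp (2 * σ * u))
            + ENNReal.ofReal (8 * h ^ 2 * Real.exp (-(2 * (1 - σ)) * u)) :=
            ENNReal.ofReal_add (by positivity) (by positivity)
        _ ≤ _ := by
            gcongr
            refine le_trans ?_ (ENNReal.le_tsum n)
            rw [Set.indicator_of_mem hmem, if_pos hyn]

open MeasureTheory in
lemma lintegral_indicator_window_le (y n : ℕ) {h σ σ₁ : ℝ} (h1 : h ≤ 1)
    (hσ₁ : 0 ≤ σ₁) (hσ : σ₁ ≤ σ) (hσ1 : σ ≤ 1) :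
    ∫⁻ u, Set.indicator (Set.Ioc (-Real.log n) (h - Real.log n))
        (fun u => if y < n then ENNReal.ofReal (2 * Real.exp (2 * σ * u)) else 0) u
      ≤ ENNReal.ofReal (2 * Real.exp 2 * h) *
          (if y < n then ENNReal.ofReal ((n : ℝ) ^ (-(2 * σ₁))) else 0) := by
  rw [lintegral_indicator measurableSet_Ioc]
  split_ifs with hyn
  · have hn : (1 : ℝ) ≤ n := by exact_mod_cast (by omega : 1 ≤ n)
    have hn0 : (0 : ℝ) < n := by linarith
    have hlog : 0 ≤ Real.log n := Real.log_nonneg hn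
    calc _ ≤ ∫⁻ _u in Set.Ioc (-Real.log n) (h - Real.log n),
          ENNReal.ofReal (2 * Real.exp 2 * (n : ℝ) ^ (-(2 * σ₁))) := by
          refine setLIntegral_mono measurable_const fun u hu => ENNReal.ofReal_le_ofReal ?_
          rw [Real.rpow_def_of_pos hn0, mul_assoc 2 (Real.exp 2), ← Real.exp_add]
          refine mul_le_mul_of_nonneg_left (Real.exp_le_exp.mpr ?_) zero_le_two
          have h2 : u ≤ h - Real.log n := hu.2
          nlinarith [mul_le_mul_of_nonneg_left h2 (hσ₁.trans hσ),
            mul_le_mul_of_nonneg_right hσ hlog]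
      _ = ENNReal.ofReal (2 * Real.exp 2 * (n : ℝ) ^ (-(2 * σ₁))) * ENNReal.ofReal h := by
          rw [setLIntegral_const, Real.volume_Ioc]; ring_nf
      _ = _ := by
          rw [← ENNReal.ofReal_mul (by positivity), ← ENNReal.ofReal_mul' (by positivity)]
          ring_nf
  · simp

open MeasureTheory in
lemma lintegral_indicator_Iic_exp {A a c : ℝ} (hA : 0 ≤ A) (ha : 0 < a) :
    ∫⁻ u, Set.indicator (Set.Iic c) (fun u => ENNReal.ofReal (A * Real.exp (a * u))) u
      = ENNReal.ofReal (A * (Real.exp (a * c) / a)) := by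
  rw [lintegral_indicator measurableSet_Iic, ← ofReal_integral_eq_lintegral_ofReal
    ((integrableOn_exp_mul_Iic ha c).const_mul A) (.of_forall fun u => by positivity),
    integral_const_mul, integral_exp_mul_Iic ha]

open MeasureTheory in
lemma lintegral_indicator_Ioi_exp {A a c : ℝ} (hA : 0 ≤ A) (ha : 0 < a) :
    ∫⁻ u, Set.indicator (Set.Ioi c) (fun u => ENNReal.ofReal (A * Real.exp (-a * u))) u
      = ENNReal.ofReal (A * (Real.exp (-a * c) / a)) := by
  rw [lintegral_indicator measurableSet_Ioi, ← ofReal_integral_eq_lintegral_ofReal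
    ((integrableOn_exp_mul_Ioi (neg_lt_zero.mpr ha) c).const_mul A)
    (.of_forall fun u => by positivity),
    integral_const_mul, integral_exp_mul_Ioi (neg_lt_zero.mpr ha), neg_div_neg_eq]

open MeasureTheory in
/-- The mean square of the window increments. The short windows contribute the diagonal sum over
`n > y`; the remaining terms are of smaller order in `h`. -/
lemma exists_lintegral_windowProfile_le (y : ℕ) {κ σ₁ σ₂ : ℝ} (hκ : 0 < κ) (hσ₁ : κ < σ₁)
    (hσ₂ : σ₂ < 1) :
    ∃ B : ℝ, 0 ≤ B ∧ ∀ h σ : ℝ, 0 < h → h ≤ 1 → σ₁ ≤ σ → σ ≤ σ₂ →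
      ∫⁻ u, ‖windowProfile χ y h σ u‖ₑ ^ 2
        ≤ ENNReal.ofReal (2 * Real.exp 2 * h) *
            (∑' n : ℕ, if y < n then ENNReal.ofReal ((n : ℝ) ^ (-(2 * σ₁))) else 0)
          + ENNReal.ofReal (B * h ^ (2 * (σ₁ - κ))) := by
  rcases lt_or_ge σ₂ σ₁ with hlt | hle
  · exact ⟨0, le_rfl, fun h σ _ _ h1 h2 => absurd (h1.trans h2) (not_le.mpr hlt)⟩
  obtain ⟨C, hC, hCx⟩ := exists_norm_windowError_le_rpow χ y hκ (by linarith)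
  have hd1 : 0 < 1 - σ₂ := by linarith
  have hd2 : 0 < σ₁ - κ := by linarith
  refine ⟨8 * Real.exp 2 / (2 * (1 - σ₂)) + C ^ 2 * 16 / (2 * (σ₁ - κ)), by positivity,
    fun h σ h0 h1 hσ hσ' => ?_⟩
  have e1 : 0 < 2 * (1 - σ) := by linarith
  have e2 : 0 < 2 * (σ - κ) := by linarith
  have hlogh : Real.log h ≤ 0 := Real.log_nonpos h0.le h1
  have hlog4 : Real.log (4 * h) = Real.log 4 + Real.log h := Real.log_mul (by norm_num) h0.ne'
  have hl4 : 0 ≤ Real.log 4 := Real.log_nonneg (by norm_num)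
  have b1 : h ^ 2 * Real.exp (-(2 * (1 - σ)) * (Real.log (4 * h) - 1))
      ≤ Real.exp 2 * h ^ (2 * (σ₁ - κ)) := by
    have : h ^ 2 = Real.exp (2 * Real.log h) := by
      rw [mul_comm, Real.exp_mul, Real.exp_log h0]; norm_cast
    rw [this, Real.rpow_def_of_pos h0, ← Real.exp_add, ← Real.exp_add, hlog4]
    refine Real.exp_le_exp.mpr ?_
    nlinarith [mul_nonneg e1.le hl4,
      mul_nonneg (by linarith : 0 ≤ σ - σ₁ + κ) (neg_nonneg.mpr hlogh)]
  have b2 : Real.exp (2 * (σ - κ) * Real.log (4 * h)) ≤ 16 * h ^ (2 * (σ₁ - κ)) := by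
    have : (16 : ℝ) = Real.exp (2 * Real.log 4) := by
      rw [mul_comm, Real.exp_mul, Real.exp_log (by norm_num)]; norm_num
    rw [this, Real.rpow_def_of_pos h0, ← Real.exp_add, hlog4]
    refine Real.exp_le_exp.mpr ?_
    nlinarith [mul_nonneg (by linarith : 0 ≤ 1 - (σ - κ)) hl4,
      mul_nonneg (by linarith : 0 ≤ σ - σ₁) (neg_nonneg.mpr hlogh)]
  have hr : 0 ≤ h ^ (2 * (σ₁ - κ)) := by positivity
  calc _ ≤ ∫⁻ u, _ := lintegral_mono fun u =>
        enorm_windowProfile_sq_le χ y (κ := κ) (σ := σ) h0 h1 (fun x hx => hCx h x h1 hx) u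
    _ = (∑' n : ℕ, ∫⁻ u, Set.indicator (Set.Ioc (-Real.log n) (h - Real.log n))
          (fun u => if y < n then ENNReal.ofReal (2 * Real.exp (2 * σ * u)) else 0) u)
        + ENNReal.ofReal (8 * h ^ 2 *
            (Real.exp (-(2 * (1 - σ)) * (Real.log (4 * h) - 1)) / (2 * (1 - σ))))
        + ENNReal.ofReal (C ^ 2 * (Real.exp (2 * (σ - κ) * Real.log (4 * h)) / (2 * (σ - κ)))) := by
      rw [lintegral_add_right, lintegral_add_right, lintegral_tsum,
        lintegral_indicator_Ioi_exp (by positivity) e1,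
        lintegral_indicator_Iic_exp (by positivity) e2]
      · intro n
        refine AEMeasurable.indicator ?_ measurableSet_Ioc
        split_ifs
        · fun_prop
        · fun_prop
      · exact Measurable.indicator (by fun_prop) measurableSet_Ioi
      · exact Measurable.indicator (by fun_prop) measurableSet_Iic
    _ ≤ ENNReal.ofReal (2 * Real.exp 2 * h) *
            (∑' n : ℕ, if y < n then ENNReal.ofReal ((n : ℝ) ^ (-(2 * σ₁))) else 0)
        + ENNReal.ofReal (8 * Real.exp 2 / (2 * (1 - σ₂)) * h ^ (2 * (σ₁ - κ)))
        + ENNReal.ofReal (C ^ 2 * 16 / (2 * (σ₁ - κ)) * h ^ (2 * (σ₁ - κ))) := by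
      rw [← ENNReal.tsum_mul_left]
      refine add_le_add (add_le_add (ENNReal.tsum_le_tsum fun n => ?_)
        (ENNReal.ofReal_le_ofReal ?_)) (ENNReal.ofReal_le_ofReal ?_)
      · exact lintegral_indicator_window_le y n h1 (by linarith) hσ (by linarith)
      · calc _ = 8 * (h ^ 2 * Real.exp (-(2 * (1 - σ)) * (Real.log (4 * h) - 1)))
                / (2 * (1 - σ)) := by ring
          _ ≤ 8 * (Real.exp 2 * h ^ (2 * (σ₁ - κ))) / (2 * (1 - σ₂)) := by gcongr
          _ = _ := by ring
      · calc _ ≤ C ^ 2 * ((16 * h ^ (2 * (σ₁ - κ))) / (2 * (σ₁ - κ))) := by gcongr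
          _ = _ := by ring
    _ = _ := by
      rw [add_assoc, ← ENNReal.ofReal_add (by positivity) (by positivity), ← add_mul]

end MeanSquare

/-! ### Mean square on vertical lines -/

section MeanSquareOnLines

variable {q : ℕ} [NeZero q] (χ : DirichletCharacter ℂ q)

open MeasureTheory in
lemma lintegral_comp_mul_left_eq {G : ℝ → ENNReal} (hG : Measurable G) {a : ℝ} (ha : a ≠ 0) :
    ∫⁻ t, G (a * t) = ENNReal.ofReal |a⁻¹| * ∫⁻ x, G x := by
  rw [← lintegral_map (μ := volume) (g := fun t => a * t) hG (by fun_prop),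
    Real.map_volume_mul_left ha, lintegral_smul_measure, smul_eq_mul]

open MeasureTheory FourierTransform in
lemma lintegral_eulerTail_sq_le (y : ℕ) {κ σ U : ℝ} (hκ : 0 < κ) (hσ : κ < σ)
    (hσ1 : σ < 1) (hU : 1 ≤ U) :
    ∫⁻ t in Set.Icc (-U) U, ‖eulerTail χ y (σ + t * Complex.I)‖ₑ ^ 2
      ≤ ENNReal.ofReal (128 * Real.pi * U ^ 2) *
        ∫⁻ u, ‖windowProfile χ y (1 / (4 * U)) σ u‖ₑ ^ 2 := by
  set h : ℝ := 1 / (4 * U) with hh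
  have hU0 : 0 < U := by linarith
  have h0 : 0 < h := by positivity
  have hUh : U * h = 1 / 4 := by rw [hh]; field_simp
  have h1 : h ≤ 1 / 4 := by nlinarith
  have hint := integrable_windowProfile χ y (h := h) (by linarith) hκ hσ hσ1
  have hL2 := memLp_two_windowProfile χ y (h := h) (by linarith) hκ hσ hσ1
  have hcont : Continuous (𝓕 (windowProfile χ y h σ)) :=
    VectorFourier.fourierIntegral_continuous Real.continuous_fourierChar
      (by exact continuous_inner) hint
  have hpt : ∀ t ∈ Set.Icc (-U) U, t ≠ 0 → ‖eulerTail χ y (σ + t * Complex.I)‖ₑ ^ 2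
      ≤ ENNReal.ofReal (64 * U ^ 2) *
        ‖𝓕 (windowProfile χ y h σ) (-(2 * Real.pi)⁻¹ * t)‖ₑ ^ 2 := by
    intro t ht ht0
    set s : ℂ := σ + t * Complex.I with hs
    have hre : s.re = σ := by simp [hs]
    have him : s.im = t := by simp [hs]
    have key := fourier_windowProfile χ y h hκ (by linarith) (s := s) (by rwa [hre])
      (by rwa [hre]) (by rwa [him])
    rw [hre, him, show -(t / (2 * Real.pi)) = -(2 * Real.pi)⁻¹ * t by ring] at key
    have hs0 : 0 < ‖s‖ := norm_pos_iff.mpr (by intro h; apply ht0; rw [← him, h]; simp)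
    have hsle : ‖s‖ ≤ σ + U := by
      refine (norm_add_le _ _).trans ?_
      rw [norm_mul, Complex.norm_I, mul_one, Complex.norm_real, Complex.norm_real,
        Real.norm_of_nonneg (by linarith : 0 ≤ σ)]
      gcongr
      exact abs_le.mpr ht
    have hz : ‖(h : ℂ) * s‖ = h * ‖s‖ := by
      rw [norm_mul, Complex.norm_real, Real.norm_of_nonneg h0.le]
    have hz2 : h * ‖s‖ ≤ 1 / 2 := by nlinarith
    -- `|e^z - 1| ≥ |z| / 2` for `|z| ≤ 1/2`; this is why `h = 1 / (4U)`.
    have hlow : h * ‖s‖ / 2 ≤ ‖Complex.exp (h * s) - 1‖ := by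
      have h2 := Complex.norm_exp_sub_one_sub_id_le (x := (h : ℂ) * s) (by rw [hz]; linarith)
      have h3 := norm_sub_norm_le ((h : ℂ) * s) (-(Complex.exp (h * s) - 1 - h * s))
      rw [norm_neg, show (h : ℂ) * s - -(Complex.exp (h * s) - 1 - h * s)
        = Complex.exp (h * s) - 1 by ring] at h3
      rw [hz] at h2 h3
      nlinarith [mul_nonneg h0.le hs0.le]
    have hnorm := congrArg norm key
    rw [norm_mul, norm_mul] at hnorm
    set F := ‖eulerTail χ y s‖
    set G := ‖𝓕 (windowProfile χ y h σ) (-(2 * Real.pi)⁻¹ * t)‖ with hG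
    have hFG : F ≤ 8 * U * G := by
      have h4 : h * ‖s‖ / 2 * F ≤ ‖s‖ * G := by
        rw [hnorm]; exact mul_le_mul_of_nonneg_right hlow (norm_nonneg _)
      have h5 : h / 2 * F ≤ G := by
        refine le_of_mul_le_mul_left ?_ hs0
        linarith
      have h6 := mul_le_mul_of_nonneg_left h5 (by positivity : 0 ≤ 8 * U)
      have h7 : 8 * U * (h / 2 * F) = F := by linear_combination 4 * F * hUh
      linarith
    rw [← ofReal_norm, ← ofReal_norm, ← ENNReal.ofReal_pow (norm_nonneg _),
      ← ENNReal.ofReal_pow (norm_nonneg _), ← ENNReal.ofReal_mul (by positivity)]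
    refine ENNReal.ofReal_le_ofReal ?_
    calc F ^ 2 ≤ (8 * U * G) ^ 2 := pow_le_pow_left₀ (norm_nonneg _) hFG 2
      _ = 64 * U ^ 2 * G ^ 2 := by ring
  calc _ ≤ ∫⁻ t in Set.Icc (-U) U, ENNReal.ofReal (64 * U ^ 2) *
        ‖𝓕 (windowProfile χ y h σ) (-(2 * Real.pi)⁻¹ * t)‖ₑ ^ 2 := by
        refine setLIntegral_mono_ae' measurableSet_Icc ?_
        filter_upwards [Measure.ae_ne volume (0 : ℝ)] with t ht0 ht
        exact hpt t ht ht0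
    _ ≤ ∫⁻ t, ENNReal.ofReal (64 * U ^ 2) *
        ‖𝓕 (windowProfile χ y h σ) (-(2 * Real.pi)⁻¹ * t)‖ₑ ^ 2 := setLIntegral_le_lintegral _ _
    _ = ENNReal.ofReal (64 * U ^ 2) * (ENNReal.ofReal (2 * Real.pi) *
        ∫⁻ ξ, ‖𝓕 (windowProfile χ y h σ) ξ‖ₑ ^ 2) := by
        have hm : Measurable fun ξ => ‖𝓕 (windowProfile χ y h σ) ξ‖ₑ ^ 2 :=
          hcont.measurable.enorm.pow_const 2
        have hpi := Real.pi_pos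
        rw [lintegral_const_mul' _ _ ENNReal.ofReal_ne_top,
          lintegral_comp_mul_left_eq hm (by simp [hpi.ne'])]
        congr 3
        rw [inv_neg, inv_inv, abs_neg, abs_of_pos (by positivity)]
    _ = _ := by
        rw [lintegral_enorm_fourier_sq hint hL2, ← mul_assoc, ← ENNReal.ofReal_mul (by positivity)]
        congr 2
        ring

lemma tendsto_tsum_nat_lt_rpow {σ : ℝ} (hσ : 1 / 2 < σ) :
    Filter.Tendsto (fun y : ℕ =>
      ∑' n : ℕ, if y < n then ENNReal.ofReal ((n : ℝ) ^ (-(2 * σ))) else 0)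
      Filter.atTop (nhds 0) := by
  have hs : Summable fun n : ℕ => (n : ℝ) ^ (-(2 * σ)) := by
    simpa using Real.summable_nat_rpow.mpr (by linarith : -(2 * σ) < -1)
  have ht : ∑' n : ℕ, ENNReal.ofReal ((n : ℝ) ^ (-(2 * σ))) ≠ ⊤ := hs.tsum_ofReal_ne_top
  have h := (ENNReal.tendsto_sum_nat_add _ ht).comp (Filter.tendsto_add_atTop_nat 1)
  refine h.congr fun y => ?_
  rw [← ENNReal.summable.sum_add_tsum_nat_add' (k := y + 1)]
  rw [Finset.sum_eq_zero, zero_add]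
  · refine tsum_congr fun n => ?_
    rw [if_pos (by omega)]
  · intro n hn
    rw [if_neg (by have := Finset.mem_range.mp hn; omega)]

open MeasureTheory Filter in
/-- Carlson's mean value theorem for `L - L_{p ≤ y}`, uniformly on vertical lines in a closed
substrip: the mean square is small once `y` is large. -/
theorem exists_lintegral_eulerTail_sq_le {σ₁ σ₂ δ : ℝ} (hσ₁ : 1 / 2 < σ₁) (hσ₂ : σ₂ < 1)
    (hδ : 0 < δ) :
    ∃ y₀ : ℕ, ∀ y, y₀ ≤ y → ∃ U₀ : ℝ, ∀ U, U₀ ≤ U → ∀ σ, σ₁ ≤ σ → σ ≤ σ₂ →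
      ∫⁻ t in Set.Icc (-U) U, ‖eulerTail χ y (σ + t * Complex.I)‖ₑ ^ 2
        ≤ ENNReal.ofReal (δ * U) := by
  have hpi := Real.pi_pos
  have hc : 0 < δ / (128 * Real.pi * Real.exp 2) := by positivity
  obtain ⟨y₀, hy₀⟩ := eventually_atTop.mp ((tendsto_tsum_nat_lt_rpow hσ₁).eventually
    (Iic_mem_nhds (ENNReal.ofReal_pos.mpr hc)))
  refine ⟨y₀, fun y hy => ?_⟩
  -- With `κ = θ / 2` the long windows contribute `O(U ^ (1 - θ))`, which is `o(U)`.
  set θ := σ₁ - 1 / 2 with hθ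
  have hθ0 : 0 < θ := by linarith
  obtain ⟨B, hB, hBle⟩ := exists_lintegral_windowProfile_le χ y (κ := θ / 2) (σ₁ := σ₁) (σ₂ := σ₂)
    (by positivity) (by linarith) hσ₂
  have hlim : Tendsto (fun U : ℝ => 128 * Real.pi * B * U ^ (-θ)) atTop (nhds 0) := by
    simpa using (tendsto_rpow_neg_atTop hθ0).const_mul (128 * Real.pi * B)
  obtain ⟨U₁, hU₁⟩ := eventually_atTop.mp (hlim.eventually (Iic_mem_nhds (half_pos hδ)))
  refine ⟨max 1 U₁, fun U hU σ hσ hσ' => ?_⟩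
  have hU1 : 1 ≤ U := (le_max_left _ _).trans hU
  have hU0 : 0 < U := by linarith
  have hb : 128 * Real.pi * B * U ^ (-θ) ≤ δ / 2 := hU₁ U ((le_max_right _ _).trans hU)
  have hS := hy₀ y hy
  have hh1 : 1 / (4 * U) ≤ 1 := by rw [div_le_one (by positivity)]; linarith
  have hpow : (1 / (4 * U)) ^ (2 * (σ₁ - θ / 2)) ≤ U ^ (-θ) * U⁻¹ := by
    have he : 2 * (σ₁ - θ / 2) = 1 + θ := by rw [hθ]; ring
    calc _ ≤ (1 / U) ^ (2 * (σ₁ - θ / 2)) := by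
          refine Real.rpow_le_rpow (by positivity) ?_ (by rw [he]; linarith)
          gcongr
          linarith
      _ = _ := by
          rw [he, one_div, Real.inv_rpow hU0.le, ← Real.rpow_neg hU0.le, ← Real.rpow_neg_one U,
            ← Real.rpow_add hU0]
          ring_nf
  calc _ ≤ ENNReal.ofReal (128 * Real.pi * U ^ 2) *
        ∫⁻ u, ‖windowProfile χ y (1 / (4 * U)) σ u‖ₑ ^ 2 :=
        lintegral_eulerTail_sq_le χ y (κ := θ / 2) (by positivity) (by linarith) (by linarith) hU1
    _ ≤ ENNReal.ofReal (128 * Real.pi * U ^ 2) *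
        (ENNReal.ofReal (2 * Real.exp 2 * (1 / (4 * U)))
            * ENNReal.ofReal (δ / (128 * Real.pi * Real.exp 2))
          + ENNReal.ofReal (B * (U ^ (-θ) * U⁻¹))) := by
        gcongr
        refine (hBle (1 / (4 * U)) σ (by positivity) hh1 hσ hσ').trans ?_
        gcongr
    _ = ENNReal.ofReal (δ / 2 * U + 128 * Real.pi * B * U ^ (-θ) * U) := by
        rw [← ENNReal.ofReal_mul (by positivity), ← ENNReal.ofReal_add (by positivity)
          (by positivity), ← ENNReal.ofReal_mul (by positivity)]
        congr 1
        field_simp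
        ring
    _ ≤ ENNReal.ofReal (δ * U) := by
        refine ENNReal.ofReal_le_ofReal ?_
        nlinarith [mul_le_mul_of_nonneg_right hb hU0.le]

end MeanSquareOnLines

/-! ### Uniformity on compact sets -/

section CompactSets

open MeasureTheory in
/-- A consequence of Cauchy's formula for `f ^ 2`: the values of `f` in the half-size disc are
controlled by the mean square of `f` on the circle. -/
lemma enorm_sq_le_lintegral_circle {f : ℂ → ℂ} {c z : ℂ} {r : ℝ} (hr : 0 < r)
    (hf : ∀ w ∈ Metric.closedBall c r, DifferentiableAt ℂ f w) (hz : z ∈ Metric.ball c (r / 2)) :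
    ‖f z‖ₑ ^ 2 ≤ ∫⁻ θ in Set.Ioc 0 (2 * Real.pi), ‖f (circleMap c r θ)‖ₑ ^ 2 := by
  have hpi := Real.pi_pos
  have hd : DiffContOnCl ℂ (fun w => f w ^ 2) (Metric.ball c r) := by
    refine DifferentiableOn.diffContOnCl fun w hw => ?_
    rw [closure_ball c hr.ne'] at hw
    exact ((hf w hw).pow 2).differentiableWithinAt
  have hz' : z ∈ Metric.ball c r := Metric.ball_subset_ball (by linarith) hz
  have hC := hd.two_pi_i_inv_smul_circleIntegral_sub_inv_smul hz'
  rw [circleIntegral, intervalIntegral.integral_of_le (by positivity), ← integral_smul] at hC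
  have hzr : dist z c < r / 2 := hz
  calc ‖f z‖ₑ ^ 2 = ‖f z ^ 2‖ₑ := by rw [enorm_pow]
    _ ≤ _ := by
      rw [← hC]
      refine (enorm_integral_le_lintegral_enorm _).trans (lintegral_mono fun θ => ?_)
      have hdist : r / 2 ≤ ‖circleMap c r θ - z‖ := by
        have h1 : dist (circleMap c r θ) c = r := by
          simp [dist_eq_norm, abs_of_pos hr]
        have h2 := dist_triangle (circleMap c r θ) z c
        rw [← dist_eq_norm]
        linarith
      rw [← enorm_pow, ← ofReal_norm, ← ofReal_norm]
      refine ENNReal.ofReal_le_ofReal ?_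
      simp only [deriv_circleMap, smul_eq_mul, norm_mul, norm_inv, Complex.norm_I, mul_one,
        norm_circleMap_zero, abs_of_pos hr, Complex.norm_ofNat, Complex.norm_real,
        Real.norm_of_nonneg hpi.le]
      have hpos : 0 < ‖circleMap c r θ - z‖ := by linarith
      have h3 : (2 * Real.pi)⁻¹ * (r * ‖circleMap c r θ - z‖⁻¹) ≤ 1 := by
        have h4 : r * ‖circleMap c r θ - z‖⁻¹ ≤ 2 := by
          rw [← div_eq_mul_inv, div_le_iff₀ hpos]; linarith
        have h5 : (2 * Real.pi)⁻¹ * 2 ≤ 1 := by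
          rw [inv_mul_le_iff₀ (by positivity)]; linarith [Real.pi_gt_three]
        calc _ ≤ (2 * Real.pi)⁻¹ * 2 := by gcongr
          _ ≤ 1 := h5
      calc _ = ((2 * Real.pi)⁻¹ * (r * ‖circleMap c r θ - z‖⁻¹)) * ‖f (circleMap c r θ) ^ 2‖ := by
            ring
        _ ≤ _ := mul_le_of_le_one_left (norm_nonneg _) h3

variable {q : ℕ} [NeZero q] (χ : DirichletCharacter ℂ q)

lemma measurable_eulerTail (y : ℕ) : Measurable (eulerTail χ y) := by
  unfold eulerTail eulerProd
  refine Measurable.sub ?_ (Finset.measurable_fun_prod _ fun p _ => by fun_prop)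
  exact measurable_of_continuousOn_compl_singleton 1 fun s hs =>
    (χ.differentiableAt_LFunction s (.inl hs)).continuousAt.continuousWithinAt

/-- The bad parameters: those `u` for which the Euler product is not within `ε` of the
`L`-function on `K + iu`. -/
def badShifts (K : Set ℂ) (ε : ℝ) (y : ℕ) : Set ℝ :=
  {u | ∃ s ∈ K, ε ≤ ‖eulerTail χ y (s + Complex.I * u)‖}

open MeasureTheory in
lemma lintegral_shift_le (y : ℕ) (w : ℂ) {V H : ℝ} (hw : |w.im| ≤ H) :
    ∫⁻ u in Set.Icc (-V) V, ‖eulerTail χ y (w + Complex.I * u)‖ₑ ^ 2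
      ≤ ∫⁻ t in Set.Icc (-(V + H)) (V + H), ‖eulerTail χ y (w.re + t * Complex.I)‖ₑ ^ 2 := by
  rw [← lintegral_indicator measurableSet_Icc, ← lintegral_indicator measurableSet_Icc,
    ← lintegral_add_left_eq_self (Set.indicator (Set.Icc (-(V + H)) (V + H)) _) w.im]
  refine lintegral_mono fun u => ?_
  obtain ⟨h1, h2⟩ := abs_le.mp hw
  by_cases hu : u ∈ Set.Icc (-V) V
  · have hu' : w.im + u ∈ Set.Icc (-(V + H)) (V + H) :=
      ⟨by linarith [hu.1], by linarith [hu.2]⟩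
    rw [Set.indicator_of_mem hu, Set.indicator_of_mem hu']
    refine le_of_eq ?_
    congr 3
    conv_lhs => rw [← Complex.re_add_im w]
    push_cast
    ring
  · simp [hu]

open MeasureTheory in
/-- The bad parameters have small density, by Cauchy's formula, the mean value theorem on
vertical lines and Markov's inequality. -/
theorem exists_volume_badShifts_le {K : Set ℂ} (hK : IsCompact K)
    (hKstrip : ∀ s ∈ K, 1 / 2 < s.re ∧ s.re < 1) {ε δ : ℝ} (hε : 0 < ε) (hδ : 0 < δ) :
    ∃ y₀ : ℕ, ∀ y, y₀ ≤ y → ∃ V₀ : ℝ, ∀ V, V₀ ≤ V →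
      volume (badShifts χ K ε y ∩ Set.Icc (-V) V) ≤ ENNReal.ofReal (δ * V) := by
  rcases K.eq_empty_or_nonempty with rfl | hne
  · exact ⟨0, fun y _ => ⟨0, fun V _ => by simp [badShifts]⟩⟩
  obtain ⟨a, haK, ha⟩ := hK.exists_isMinOn hne Complex.continuous_re.continuousOn
  obtain ⟨b, hbK, hb⟩ := hK.exists_isMaxOn hne Complex.continuous_re.continuousOn
  obtain ⟨H₀, hH₀⟩ := hK.exists_bound_of_continuousOn Complex.continuous_im.continuousOn
  have ha' := (hKstrip a haK).1
  have hb' := (hKstrip b hbK).2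
  set r : ℝ := min (a.re - 1 / 2) (1 - b.re) / 2 with hr
  have hr0 : 0 < r := half_pos (lt_min (by linarith) (by linarith))
  have hra : 2 * r ≤ a.re - 1 / 2 := by rw [hr]; linarith [min_le_left (a.re - 1 / 2) (1 - b.re)]
  have hrb : 2 * r ≤ 1 - b.re := by rw [hr]; linarith [min_le_right (a.re - 1 / 2) (1 - b.re)]
  have hball : ∀ c ∈ K, ∀ w ∈ Metric.closedBall c r,
      a.re - r ≤ w.re ∧ w.re ≤ b.re + r ∧ |w.im| ≤ H₀ + r := by
    intro c hc w hw
    have hd : ‖w - c‖ ≤ r := by rw [← dist_eq_norm]; exact hw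
    have h1 := abs_le.mp ((Complex.abs_re_le_norm (w - c)).trans hd)
    have h2 := (Complex.abs_im_le_norm (w - c)).trans hd
    have h3 : a.re ≤ c.re := ha hc
    have h4 : c.re ≤ b.re := hb hc
    have h5 := hH₀ c hc
    rw [Real.norm_eq_abs] at h5
    simp only [Complex.sub_re, Complex.sub_im] at h1 h2
    refine ⟨by linarith [h1.1], by linarith [h1.2], ?_⟩
    have := abs_add_le (w.im - c.im) c.im
    rw [sub_add_cancel] at this
    linarith
  have hH : 0 ≤ H₀ + r :=
    (abs_nonneg _).trans (hball a haK a (Metric.mem_closedBall_self hr0.le)).2.2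
  obtain ⟨t, htK, htf, htc⟩ := hK.finite_cover_balls (half_pos hr0)
  lift t to Finset ℂ using htf
  have hpi := Real.pi_pos
  set N : ℝ := t.card + 1 with hN
  have hN0 : 0 < N := by positivity
  obtain ⟨y₀, hy₀⟩ := exists_lintegral_eulerTail_sq_le χ (σ₁ := a.re - r) (σ₂ := b.re + r)
    (δ := δ * ε ^ 2 / (4 * Real.pi * N)) (by linarith) (by linarith) (by positivity)
  refine ⟨y₀, fun y hy => ?_⟩
  obtain ⟨U₀, hU₀⟩ := hy₀ y hy
  refine ⟨max (max U₀ 0) (H₀ + r), fun V hV => ?_⟩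
  have hVH : H₀ + r ≤ V := (le_max_right _ _).trans hV
  have hVU : U₀ ≤ V := (le_max_left _ _).trans ((le_max_left _ _).trans hV)
  have hV0 : 0 ≤ V := (le_max_right _ _).trans ((le_max_left _ _).trans hV)
  have hmeas : ∀ c : ℂ, Measurable (Function.uncurry fun u θ : ℝ =>
      ‖eulerTail χ y (circleMap c r θ + Complex.I * u)‖ₑ ^ 2) := by
    intro c
    refine ((measurable_eulerTail χ y).comp (Continuous.measurable ?_)).enorm.pow_const 2
    exact ((continuous_circleMap c r).comp continuous_snd).add
      (continuous_const.mul (Complex.continuous_ofReal.comp continuous_fst))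
  set G : ℝ → ENNReal := fun u => ∑ c ∈ t, ∫⁻ θ in Set.Ioc 0 (2 * Real.pi),
    ‖eulerTail χ y (circleMap c r θ + Complex.I * u)‖ₑ ^ 2 with hG
  have hGc : ∀ c : ℂ, Measurable fun u : ℝ => ∫⁻ θ in Set.Ioc 0 (2 * Real.pi),
      ‖eulerTail χ y (circleMap c r θ + Complex.I * u)‖ₑ ^ 2 := fun c =>
    (hmeas c).lintegral_prod_right'
  have hGm : Measurable G := Finset.measurable_fun_sum _ fun c _ => hGc c
  have hsub : badShifts χ K ε y ∩ Set.Icc (-V) V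
      ⊆ {u | ENNReal.ofReal (ε ^ 2) ≤ G u} ∩ Set.Icc (-V) V := by
    rintro u ⟨⟨s, hs, hsu⟩, hu⟩
    refine ⟨?_, hu⟩
    obtain ⟨c, hc, hsc⟩ := Set.mem_iUnion₂.mp (htc hs)
    have h1 := enorm_sq_le_lintegral_circle (f := fun z => eulerTail χ y (z + Complex.I * u))
      hr0 (fun w hw => ?_) hsc
    · calc ENNReal.ofReal (ε ^ 2) ≤ ‖eulerTail χ y (s + Complex.I * u)‖ₑ ^ 2 := by
            rw [← ofReal_norm, ← ENNReal.ofReal_pow (norm_nonneg _)]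
            exact ENNReal.ofReal_le_ofReal (pow_le_pow_left₀ hε.le hsu 2)
        _ ≤ _ := h1
        _ ≤ G u := Finset.single_le_sum (f := fun c => ∫⁻ θ in Set.Ioc 0 (2 * Real.pi),
            ‖eulerTail χ y (circleMap c r θ + Complex.I * u)‖ₑ ^ 2) (fun _ _ => zero_le) hc
    · obtain ⟨hw1, hw2, -⟩ := hball c (htK hc) w hw
      have hre : (w + Complex.I * u).re = w.re := by simp
      have hd := differentiableAt_eulerTail χ y (s := w + Complex.I * u) (by rw [hre]; linarith)
        (fun h => by rw [h] at hre; simp at hre; linarith)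
      exact hd.comp w (differentiableAt_id.add_const _)
  have hGint : ∫⁻ u in Set.Icc (-V) V, G u ≤ ENNReal.ofReal (ε ^ 2 * (δ * V)) := by
    rw [hG, lintegral_finsetSum _ fun c _ => hGc c]
    have hone : ∀ c ∈ t, ∫⁻ u in Set.Icc (-V) V, ∫⁻ θ in Set.Ioc 0 (2 * Real.pi),
        ‖eulerTail χ y (circleMap c r θ + Complex.I * u)‖ₑ ^ 2
        ≤ ENNReal.ofReal (ε ^ 2 * (δ * V) / N) := by
      intro c hc
      rw [lintegral_lintegral_swap (hmeas c).aemeasurable]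
      calc _ ≤ ∫⁻ _θ in Set.Ioc 0 (2 * Real.pi),
            ENNReal.ofReal (δ * ε ^ 2 / (4 * Real.pi * N) * (V + (H₀ + r))) := by
            refine lintegral_mono fun θ => ?_
            obtain ⟨h1, h2, h3⟩ := hball c (htK hc) _ (circleMap_mem_closedBall c hr0.le θ)
            exact (lintegral_shift_le χ y _ h3).trans (hU₀ _ (by linarith) _ h1 h2)
        _ = ENNReal.ofReal (δ * ε ^ 2 / (4 * Real.pi * N) * (V + (H₀ + r)) * (2 * Real.pi)) := by
            rw [setLIntegral_const, Real.volume_Ioc, sub_zero, ← ENNReal.ofReal_mul (by positivity)]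
        _ ≤ _ := by
            refine ENNReal.ofReal_le_ofReal ?_
            calc _ ≤ δ * ε ^ 2 / (4 * Real.pi * N) * (V + V) * (2 * Real.pi) := by gcongr
              _ = _ := by field_simp; ring
    calc _ ≤ ∑ c ∈ t, ENNReal.ofReal (ε ^ 2 * (δ * V) / N) := Finset.sum_le_sum hone
      _ = ENNReal.ofReal (t.card * (ε ^ 2 * (δ * V) / N)) := by
        rw [Finset.sum_const, nsmul_eq_mul, ENNReal.ofReal_mul (Nat.cast_nonneg _),
          ENNReal.ofReal_natCast]
      _ ≤ _ := by
        refine ENNReal.ofReal_le_ofReal ?_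
        rw [mul_div_assoc', div_le_iff₀ hN0, mul_comm]
        gcongr
        linarith
  have hε2 : 0 < ε ^ 2 := by positivity
  have hmarkov := mul_meas_ge_le_lintegral (μ := volume.restrict (Set.Icc (-V) V)) hGm
    (ENNReal.ofReal (ε ^ 2))
  rw [Measure.restrict_apply (measurableSet_le measurable_const hGm)] at hmarkov
  have h2 := (hmarkov.trans hGint)
  rw [ENNReal.ofReal_mul hε2.le] at h2
  exact (measure_mono hsub).trans ((ENNReal.mul_le_mul_iff_right
    (ENNReal.ofReal_pos.mpr hε2).ne' ENNReal.ofReal_ne_top).mp h2)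

end CompactSets

/-! ### The curve `γ` -/

section Curve

variable {a b α : ℝ}

lemma hasDerivAt_gammaCurve (a b α : ℝ) {t : ℝ} (ht : 1 < t) :
    HasDerivAt (gammaCurve α a b) (gammaCurve α a b t / t * (a + b / Real.log t)) t := by
  have ht0 : 0 < t := by linarith
  have hlog : 0 < Real.log t := Real.log_pos ht
  have h1 : HasDerivAt (fun x : ℝ => x ^ a) (a * t ^ (a - 1)) t :=
    Real.hasDerivAt_rpow_const (.inl ht0.ne')
  have h2 := (Real.hasDerivAt_log ht0.ne').rpow_const (p := b) (.inl hlog.ne')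
  have h3 := (h1.const_mul α).mul h2
  convert! h3 using 1
  rw [Real.rpow_sub_one ht0.ne', Real.rpow_sub_one hlog.ne', gammaCurve]
  field_simp

lemma gammaCurve_one_pos (a b : ℝ) {t : ℝ} (ht : 1 < t) : 0 < gammaCurve 1 a b t := by
  have : 0 < t := by linarith
  have := Real.log_pos ht
  unfold gammaCurve
  positivity

lemma gammaCurve_eq_mul (α a b t : ℝ) : gammaCurve α a b t = α * gammaCurve 1 a b t := by
  simp only [gammaCurve]; ring

/-- Beyond this point the logarithmic derivative of the curve is at least `a / (2t)`. -/
noncomputable def curveStart (a b : ℝ) : ℝ := Real.exp (2 * |b| / a + 1)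

lemma one_lt_curveStart (ha : 0 < a) : 1 < curveStart a b :=
  Real.one_lt_exp_iff.mpr (by positivity)

lemma half_le_add_div_log (ha : 0 < a) {t : ℝ} (ht : curveStart a b ≤ t) :
    a / 2 ≤ a + b / Real.log t := by
  have ht0 : 0 < t := (Real.exp_pos _).trans_le ht
  have h1 : 2 * |b| / a + 1 ≤ Real.log t := (Real.le_log_iff_exp_le ht0).mpr ht
  have h2 : 0 ≤ 2 * |b| / a := by positivity
  have hlog : 0 < Real.log t := by linarith
  have h3 : |b / Real.log t| ≤ a / 2 := by
    rw [abs_div, abs_of_pos hlog, div_le_iff₀ hlog]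
    have h4 : 2 * |b| / a ≤ Real.log t := by linarith
    rw [div_le_iff₀ ha] at h4
    linarith
  linarith [(abs_le.mp h3).1]

lemma strictMonoOn_gammaCurve (ha : 0 < a) :
    StrictMonoOn (gammaCurve 1 a b) (Set.Ici (curveStart a b)) := by
  have h1 := one_lt_curveStart (b := b) ha
  refine strictMonoOn_of_deriv_pos (convex_Ici _) (fun t ht =>
    (hasDerivAt_gammaCurve a b 1 (h1.trans_le ht)).continuousAt.continuousWithinAt) fun t ht => ?_
  rw [interior_Ici] at ht
  have ht1 : 1 < t := h1.trans ht
  rw [(hasDerivAt_gammaCurve a b 1 ht1).deriv]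
  have := half_le_add_div_log ha (Set.mem_Ioi.mp ht).le
  have := gammaCurve_one_pos a b ht1
  have : 0 < a + b / Real.log t := by linarith
  have : 0 < t := by linarith
  positivity

open Filter in
lemma tendsto_gammaCurve_one (ha : 0 < a) : Tendsto (gammaCurve 1 a b) atTop atTop := by
  have h1 : Tendsto (fun t : ℝ => Real.log t ^ (-b) / t ^ a) atTop (nhdsWithin 0 (Set.Ioi 0)) := by
    refine tendsto_nhdsWithin_iff.mpr
      ⟨(isLittleO_log_rpow_rpow_atTop (-b) ha).tendsto_div_nhds_zero, ?_⟩
    filter_upwards [eventually_gt_atTop 1] with t ht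
    have : 0 < t := by linarith
    have := Real.log_pos ht
    exact Set.mem_Ioi.mpr (by positivity)
  refine h1.inv_tendsto_nhdsGT_zero.congr' ?_
  filter_upwards [eventually_gt_atTop 1] with t ht
  have hlog := Real.log_pos ht
  simp only [Pi.inv_apply, gammaCurve, Real.rpow_neg hlog.le]
  field_simp

/-- The curve varies regularly: it is comparable at `T` and at `η T`. -/
lemma gammaCurve_mul_ge (a b : ℝ) {η T : ℝ} (hη : 0 < η) (hη1 : η < 1) (hT : 1 / η ^ 2 < T) :
    η ^ a * (1 / 2) ^ |b| * gammaCurve 1 a b T ≤ gammaCurve 1 a b (η * T) := by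
  have hT1 : 1 < T := lt_of_le_of_lt (by
    rw [le_div_iff₀ (by positivity), one_mul]; nlinarith) hT
  have hT0 : 0 < T := by linarith
  have hlog := Real.log_pos hT1
  have hlogη : Real.log η < 0 := Real.log_neg hη hη1
  have h1 : Real.log (η * T) = Real.log η + Real.log T := Real.log_mul hη.ne' hT0.ne'
  have h2 : -(2 * Real.log η) < Real.log T := by
    have := Real.log_lt_log (by positivity) hT
    rwa [one_div, Real.log_inv, Real.log_pow, Nat.cast_ofNat] at this
  set ρ := Real.log (η * T) / Real.log T with hρ
  have hρ1 : ρ ≤ 1 := by rw [hρ, div_le_one hlog]; linarith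
  have hρ2 : 1 / 2 ≤ ρ := by rw [hρ, le_div_iff₀ hlog]; linarith
  have hρb : (1 / 2) ^ |b| ≤ ρ ^ b :=
    (Real.rpow_le_rpow (by norm_num) hρ2 (abs_nonneg b)).trans
      (Real.rpow_le_rpow_of_exponent_ge (by linarith) hρ1 (le_abs_self b))
  have h3 : Real.log (η * T) = ρ * Real.log T := by rw [hρ]; field_simp
  simp only [gammaCurve, one_mul]
  rw [h3, Real.mul_rpow hη.le hT0.le, Real.mul_rpow (by linarith) hlog.le]
  calc _ = η ^ a * T ^ a * ((1 / 2) ^ |b| * Real.log T ^ b) := by ring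
    _ ≤ _ := by gcongr

lemma measurable_gammaCurve (α a b : ℝ) : Measurable (gammaCurve α a b) := by
  unfold gammaCurve
  exact (measurable_const.mul (measurable_id.pow_const a)).mul (Real.measurable_log.pow_const b)

open MeasureTheory in
/-- Pulling back along the curve multiplies densities by at most a constant: on `[ηT, T]` the
curve is injective and its speed is at least a constant times its average speed `|γ(T)| / T`. -/
lemma volume_preimage_gammaCurve_le (ha : 0 < a) (hα : α ≠ 0) {η T : ℝ} (hη : 0 < η) (hη1 : η < 1)
    (hT : 1 / η ^ 2 < T) (hTs : curveStart a b ≤ η * T) (B : Set ℝ) {D : ℝ}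
    (hB : volume (B ∩ Set.Icc (-|gammaCurve α a b T|) |gammaCurve α a b T|)
      ≤ ENNReal.ofReal (D * |gammaCurve α a b T|)) :
    volume (Set.Icc (η * T) T ∩ gammaCurve α a b ⁻¹' B)
      ≤ ENNReal.ofReal (D / (a / 2 * (η ^ a * (1 / 2) ^ |b|)) * T) := by
  have hs1 := one_lt_curveStart (b := b) ha
  have hηT : 1 < η * T := hs1.trans_le hTs
  have hT0 : 0 < T := by
    by_contra h
    nlinarith [mul_nonpos_of_nonneg_of_nonpos hη.le (not_lt.mp h)]
  have hTT : η * T ≤ T := by nlinarith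
  set V := |gammaCurve α a b T| with hV
  set c := a / 2 * (η ^ a * (1 / 2) ^ |b|) with hc
  have hc0 : 0 < c := by positivity
  have hgT := gammaCurve_one_pos a b (hηT.trans_le hTT)
  have hVeq : V = |α| * gammaCurve 1 a b T := by
    rw [hV, gammaCurve_eq_mul, abs_mul, abs_of_pos hgT]
  have hα0 : 0 < |α| := abs_pos.mpr hα
  have hV0 : 0 < V := by rw [hVeq]; positivity
  have hmono := strictMonoOn_gammaCurve (b := b) ha
  have hmem : ∀ τ ∈ Set.Icc (η * T) T, curveStart a b ≤ τ := fun τ hτ => hTs.trans hτ.1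
  have hle : ∀ τ ∈ Set.Icc (η * T) T, |gammaCurve α a b τ| ≤ V := by
    intro τ hτ
    rw [hVeq, gammaCurve_eq_mul, abs_mul, abs_of_pos (gammaCurve_one_pos a b (hηT.trans_le hτ.1))]
    exact mul_le_mul_of_nonneg_left
      (hmono.monotoneOn (hmem τ hτ) (hmem T ⟨hTT, le_rfl⟩) hτ.2) hα0.le
  have hspeed : ∀ τ ∈ Set.Icc (η * T) T,
      c * V / T ≤ |gammaCurve α a b τ / τ * (a + b / Real.log τ)| := by
    intro τ hτ
    have hτ1 : 1 < τ := hηT.trans_le hτ.1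
    have hτ0 : 0 < τ := by linarith
    have hg := gammaCurve_one_pos a b hτ1
    have h1 := half_le_add_div_log ha (hmem τ hτ)
    have h2 : η ^ a * (1 / 2) ^ |b| * gammaCurve 1 a b T ≤ gammaCurve 1 a b τ :=
      (gammaCurve_mul_ge a b hη hη1 hT).trans
        (hmono.monotoneOn hTs (hmem τ hτ) hτ.1)
    rw [gammaCurve_eq_mul, abs_mul, abs_div, abs_mul, abs_of_pos hg, abs_of_pos hτ0,
      abs_of_pos (by linarith : 0 < a + b / Real.log τ)]
    calc c * V / T = |α| * (η ^ a * (1 / 2) ^ |b| * gammaCurve 1 a b T) / T * (a / 2) := by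
          rw [hVeq, hc]; ring
      _ ≤ _ := by
        gcongr
        exact hτ.2
  set M := toMeasurable volume (B ∩ Set.Icc (-V) V) with hM
  set S := Set.Icc (η * T) T ∩ gammaCurve α a b ⁻¹' M with hS
  have hSm : MeasurableSet S :=
    measurableSet_Icc.inter (measurable_gammaCurve α a b (measurableSet_toMeasurable _ _))
  have hinj : Set.InjOn (gammaCurve α a b) S := by
    intro x hx z hz hxz
    rw [gammaCurve_eq_mul, gammaCurve_eq_mul α a b z] at hxz
    exact hmono.injOn (hmem x hx.1) (hmem z hz.1) (mul_left_cancel₀ hα hxz)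
  have himg := lintegral_image_eq_lintegral_abs_deriv_mul hSm
    (fun τ hτ => (hasDerivAt_gammaCurve a b α (hηT.trans_le hτ.1.1)).hasDerivWithinAt) hinj
    (fun _ => 1)
  simp only [mul_one, lintegral_const, one_mul, Measure.restrict_apply MeasurableSet.univ,
    Set.univ_inter] at himg
  have hlow : ENNReal.ofReal (c * V / T) * volume S ≤ ENNReal.ofReal (D * V) := by
    calc _ = ∫⁻ _τ in S, ENNReal.ofReal (c * V / T) := by rw [setLIntegral_const]
      _ ≤ ∫⁻ τ in S, ENNReal.ofReal |gammaCurve α a b τ / τ * (a + b / Real.log τ)| :=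
          setLIntegral_mono' hSm fun τ hτ => ENNReal.ofReal_le_ofReal (hspeed τ hτ.1)
      _ = volume (gammaCurve α a b '' S) := himg.symm
      _ ≤ volume M := measure_mono (by rintro _ ⟨τ, hτ, rfl⟩; exact hτ.2)
      _ ≤ _ := by rw [hM, measure_toMeasurable]; exact hB
  have hsub : Set.Icc (η * T) T ∩ gammaCurve α a b ⁻¹' B ⊆ S := fun τ hτ =>
    ⟨hτ.1, subset_toMeasurable _ _ ⟨hτ.2, abs_le.mp (hle τ hτ.1)⟩⟩
  refine (measure_mono hsub).trans ?_
  have hpos : 0 < c * V / T := by positivity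
  rw [show D * V = c * V / T * (D / c * T) by field_simp, ENNReal.ofReal_mul hpos.le] at hlow
  exact (ENNReal.mul_le_mul_iff_right (ENNReal.ofReal_pos.mpr hpos).ne'
    ENNReal.ofReal_ne_top).mp hlow

end Curve

open MeasureTheory Filter in
theorem lemma3p1 {q : ℕ} [NeZero q] (χ : DirichletCharacter ℂ q)
    (a b α : ℝ) (ha : 0 < a) (hα : α ≠ 0)
    (K : Set ℂ) (hK : IsCompact K) (hKstrip : ∀ s ∈ K, 1 / 2 < s.re ∧ s.re < 1)
    (ε : ℝ) (hε : 0 < ε) :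
    ∃ y₀ : ℕ, ∀ y : ℕ, y₀ ≤ y → ∃ T₀ : ℝ, ∀ T : ℝ, T₀ ≤ T →
      (1 - ε) * T < MeasureTheory.volume.real
        {τ : ℝ | τ ∈ Set.Ioc 1 T ∧ ∀ s ∈ K,
          ‖χ.LFunction (s + Complex.I * (gammaCurve α a b τ : ℂ))
            - eulerProd (primesUpTo y) (s + Complex.I * (gammaCurve α a b τ : ℂ))
                (fun _ => 0) χ‖ < ε} := by
  -- The discarded range `[0, ηT]` and the pulled back bad set each have measure at most `εT / 4`.
  set η : ℝ := min ε 1 / 4 with hη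
  have hη0 : 0 < η := by have := lt_min hε one_pos; positivity
  have hη1 : η < 1 := by have := min_le_right ε 1; rw [hη]; linarith
  have hηε : η ≤ ε / 4 := by have := min_le_left ε 1; rw [hη]; linarith
  set c : ℝ := a / 2 * (η ^ a * (1 / 2) ^ |b|) with hc
  have hc0 : 0 < c := by positivity
  obtain ⟨y₀, hy₀⟩ := exists_volume_badShifts_le χ hK hKstrip hε
    (mul_pos hη0 hc0)
  refine ⟨y₀, fun y hy => ?_⟩
  obtain ⟨V₀, hV₀⟩ := hy₀ y hy
  have hlim : Tendsto (fun T => |gammaCurve α a b T|) atTop atTop := by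
    have h := (tendsto_gammaCurve_one (b := b) ha).const_mul_atTop (abs_pos.mpr hα)
    refine tendsto_atTop_mono (fun T => ?_) h
    rw [gammaCurve_eq_mul α, abs_mul]
    gcongr
    exact le_abs_self _
  obtain ⟨T₁, hT₁⟩ := eventually_atTop.mp (hlim.eventually (eventually_ge_atTop V₀))
  refine ⟨max (max T₁ (1 / η ^ 2 + 1)) (curveStart a b / η), fun T hT => ?_⟩
  have hTT₁ : T₁ ≤ T := (le_max_left _ _).trans ((le_max_left _ _).trans hT)
  have hTη : 1 / η ^ 2 < T :=
    (lt_add_one _).trans_le ((le_max_right _ _).trans ((le_max_left _ _).trans hT))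
  have hTs : curveStart a b ≤ η * T := by
    have := (le_max_right _ _).trans hT
    rwa [div_le_iff₀ hη0, mul_comm] at this
  have hηT : 1 < η * T := (one_lt_curveStart ha).trans_le hTs
  have hT0 : 0 < T := lt_trans (by positivity) hTη
  have hbad := volume_preimage_gammaCurve_le ha hα hη0 hη1 hTη hTs _ (hV₀ _ (hT₁ T hTT₁))
  rw [← hc, mul_div_cancel_right₀ _ hc0.ne'] at hbad
  set good := {τ : ℝ | τ ∈ Set.Ioc 1 T ∧ ∀ s ∈ K,
    ‖χ.LFunction (s + Complex.I * (gammaCurve α a b τ : ℂ))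
      - eulerProd (primesUpTo y) (s + Complex.I * (gammaCurve α a b τ : ℂ))
          (fun _ => 0) χ‖ < ε} with hgood
  have hcover : Set.Icc (η * T) T
      ⊆ good ∪ (Set.Icc (η * T) T ∩ gammaCurve α a b ⁻¹' badShifts χ K ε y) := by
    intro τ hτ
    by_cases h : gammaCurve α a b τ ∈ badShifts χ K ε y
    · exact Or.inr ⟨hτ, h⟩
    · refine Or.inl ⟨⟨hηT.trans_le hτ.1, hτ.2⟩, fun s hs => ?_⟩
      by_contra hlt
      exact h ⟨s, hs, not_lt.mp hlt⟩
  have hfin : volume good ≠ ⊤ :=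
    ne_top_of_le_ne_top measure_Ioc_lt_top.ne (measure_mono (t := Set.Ioc 1 T) fun τ hτ => hτ.1)
  have hmeas := (measure_mono hcover).trans (measure_union_le (μ := volume) _ _)
  have hreal : T - η * T ≤ volume.real good + η * T := by
    have h1 : ENNReal.ofReal (T - η * T) ≤ ENNReal.ofReal (volume.real good + η * T) := by
      rw [ENNReal.ofReal_add measureReal_nonneg (by positivity), ofReal_measureReal hfin,
        ← Real.volume_Icc]
      exact hmeas.trans (by gcongr)
    exact (ENNReal.ofReal_le_ofReal_iff (add_nonneg measureReal_nonneg (by positivity))).mp h1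
  have h2 := mul_le_mul_of_nonneg_right hηε hT0.le
  nlinarith [mul_pos hε hT0]
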